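/- Let $F_2=\langle a,b\rangle$ be the free group on two generators, let $|w|$ be the length of the reduced word of $w\in F_2$, and call $w$ minimal if $|\phi(w)|\ge |w|$ for all $\phi\in\operatorname{Aut}F_2$. An automorphic conjugacy class $W$ is an orbit of $\operatorname{Aut}F_2$ on $F_2$; its minimal words all have the same length. Put $L_2=\{a,b,a^{-1},b^{-1}\}$. A permutation is an automorphism of $F_2$ that permutes $L_2$; let $J$ be the subgroup of $\operatorname{Aut}F_2$ generated by the inner automorphisms and the permutations, and let $[w]$ be the $J$-orbit of $w$. A one-letter automorphism is an automorphism with $x\mapsto x$, $y\mapsto yx$ for some $x,y\in L_2$ with $y\notin\{x,x^{-1}\}$. The directed multigraph $\Gamma(W)$ has as vertices the classes $[w]$ of the minimal words $w$ in $W$, and it has one edge from $[w]$ to $[v]$ ($w$, $v$ minimal) for each class $[\phi]$ modulo inner automorphisms of one-letter automorphisms $\phi$ with $\phi(w)\in[v]$; the number of edges does not depend on the representatives. Let $n\ge 9$. If $W$ is an automorphic conjugacy class in $F_2$ whose minimal words have length $n$, then $\Gamma(W)$ has at most $n-5$ vertices, and $W$ contains at most $8n^2-40n$ minimal words. Both bounds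 are sharp for every $n\ge 9$: there is an automorphic conjugacy class $W$ whose minimal words have length $n$ such that $\Gamma(W)$ has exactly $n-5$ vertices and $W$ contains exactly $8n^2-40n$ minimal words. -/

import Mathlib

namespace FreeTwo

/-- The free group `F₂ = ⟨a, b⟩` on two generators. -/
abbrev F₂ : Type := FreeGroup (Fin 2)

/-- The generator `a`. -/
def a : F₂ := FreeGroup.of 0

/-- The generator `b`. -/
def b : F₂ := FreeGroup.of 1

/-- The set of letters `L₂ = {a, b, a⁻¹, b⁻¹}`. -/
def letters : Set F₂ := {a, b, a⁻¹, b⁻¹}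

/-- `w` is minimal: no automorphism of `F₂` makes it shorter.
`FreeGroup.norm` is the length of the reduced word. -/
def IsMinimal (w : F₂) : Prop :=
  ∀ φ : MulAut F₂, w.norm ≤ (φ w).norm

/-- An automorphic conjugacy class: an orbit of `Aut F₂` acting on `F₂`. -/
def IsAutConjClass (W : Set F₂) : Prop :=
  ∃ w : F₂, W = {v | ∃ φ : MulAut F₂, φ w = v}

/-- The set of minimal words of `W`. -/
def minimalWords (W : Set F₂) : Set F₂ :=
  {w | w ∈ W ∧ IsMinimal w}

/-- The subgroup of inner automorphisms. -/
def Inn : Subgroup (MulAut F₂) := (MulAut.conj : F₂ →* MulAut F₂).range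

instance : Inn.Normal where
  conj_mem := by
    rintro _ ⟨g, rfl⟩ φ
    refine ⟨φ g, ?_⟩
    ext x
    simp [MulAut.conj_apply, MulAut.mul_apply]

/-- A permutation (type I automorphism): an automorphism that permutes the letters. -/
def IsPermutation (π : MulAut F₂) : Prop :=
  π '' letters = letters

/-- The subgroup `J` generated by the inner automorphisms and the permutations. -/
def J : Subgroup (MulAut F₂) :=
  Subgroup.closure ({φ | φ ∈ Inn} ∪ {φ | IsPermutation φ})

/-- The class `[w]` of `w` under the relation `w ∼_J v`: some `φ ∈ J` maps `w` to `v`. -/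
def classJ (w : F₂) : Set F₂ :=
  {v | ∃ φ ∈ J, φ w = v}

/-- A one-letter automorphism `({y}, x)`, with letters `x`, `y` such that `y ∉ {x, x⁻¹}`:
it maps `x ↦ x` and `y ↦ y x`. -/
def IsOneLetter (φ : MulAut F₂) : Prop :=
  ∃ x ∈ letters, ∃ y ∈ letters, y ≠ x ∧ y ≠ x⁻¹ ∧ φ x = x ∧ φ y = y * x

/-- The classes `[φ]` modulo inner automorphisms of the one-letter automorphisms `φ`
with `φ(w)` in the set `q`. -/
def edgeClasses (w : F₂) (q : Set F₂) : Set (MulAut F₂ ⧸ Inn) :=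
  {c | ∃ φ : MulAut F₂, IsOneLetter φ ∧ (φ : MulAut F₂ ⧸ Inn) = c ∧ φ w ∈ q}

/-- The vertices of `Γ(W)`: the classes `[w]` of the minimal words `w` of `W`. -/
def Gamma (W : Set F₂) : Type :=
  {p : Set F₂ // ∃ w ∈ minimalWords W, p = classJ w}

/-- A minimal word representing a vertex. -/
noncomputable def Gamma.rep {W : Set F₂} (p : Gamma W) : F₂ := p.2.choose

/-- The directed multigraph structure of `Γ(W)`: one edge from `[w]` to `[v]` for each class
`[φ]` modulo inner automorphisms of one-letter automorphisms such that `φ(w) ∈ [v]`. The number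
of edges does not depend on the representative `w`, see `ncard_edgeClasses`. -/
noncomputable instance (W : Set F₂) : Quiver (Gamma W) where
  Hom p q := edgeClasses p.rep q.1

theorem isPermutation_inv {π : MulAut F₂} (h : IsPermutation π) : IsPermutation π⁻¹ := by
  unfold IsPermutation at *
  conv_lhs => rw [← h]
  rw [← Set.image_comp]
  convert Set.image_id letters using 2
  simp

theorem isOneLetter_conj {π φ : MulAut F₂} (h : IsPermutation π) (hφ : IsOneLetter φ) :
    IsOneLetter (π * φ * π⁻¹) := by
  obtain ⟨x, hx, y, hy, h1, h2, h3, h4⟩ := hφ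
  have hm : ∀ z ∈ letters, π z ∈ letters := fun z hz => h ▸ Set.mem_image_of_mem π hz
  refine ⟨π x, hm x hx, π y, hm y hy, π.injective.ne h1, ?_, ?_, ?_⟩
  · rw [← map_inv]
    exact π.injective.ne h2
  · simp [MulAut.mul_apply, h3]
  · simp [MulAut.mul_apply, h4]

theorem oneLetter_conj_J {g : MulAut F₂} (hg : g ∈ J) :
    (∀ φ, IsOneLetter φ → ∃ ψ, IsOneLetter ψ ∧
      (ψ : MulAut F₂ ⧸ Inn) = (g * φ * g⁻¹ : MulAut F₂)) ∧
    (∀ φ, IsOneLetter φ → ∃ ψ, IsOneLetter ψ ∧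
      (ψ : MulAut F₂ ⧸ Inn) = (g⁻¹ * φ * g : MulAut F₂)) := by
  refine Subgroup.closure_induction (p := fun g _ =>
    (∀ φ, IsOneLetter φ → ∃ ψ, IsOneLetter ψ ∧
      (ψ : MulAut F₂ ⧸ Inn) = (g * φ * g⁻¹ : MulAut F₂)) ∧
    (∀ φ, IsOneLetter φ → ∃ ψ, IsOneLetter ψ ∧
      (ψ : MulAut F₂ ⧸ Inn) = (g⁻¹ * φ * g : MulAut F₂))) ?_ ?_ ?_ ?_ hg
  · rintro x (hx | hx)
    · have hx1 : (x : MulAut F₂ ⧸ Inn) = 1 := (QuotientGroup.eq_one_iff x).2 hx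
      constructor <;> intro φ hφ <;> refine ⟨φ, hφ, ?_⟩ <;>
        simp [QuotientGroup.mk_mul, QuotientGroup.mk_inv, hx1]
    · refine ⟨fun φ hφ => ⟨_, isOneLetter_conj hx hφ, rfl⟩, fun φ hφ => ?_⟩
      have := isOneLetter_conj (isPermutation_inv hx) hφ
      rw [inv_inv] at this
      exact ⟨_, this, rfl⟩
  · constructor <;> intro φ hφ <;> exact ⟨φ, hφ, by simp⟩
  · rintro x y _ _ ⟨hx, hx'⟩ ⟨hy, hy'⟩
    constructor
    · intro φ hφ
      obtain ⟨ψ, hψ, e⟩ := hy φ hφ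
      obtain ⟨χ, hχ, e'⟩ := hx ψ hψ
      refine ⟨χ, hχ, ?_⟩
      simp only [e', QuotientGroup.mk_mul, e, QuotientGroup.mk_inv]
      group
    · intro φ hφ
      obtain ⟨ψ, hψ, e⟩ := hx' φ hφ
      obtain ⟨χ, hχ, e'⟩ := hy' ψ hψ
      refine ⟨χ, hχ, ?_⟩
      simp only [e', QuotientGroup.mk_mul, e, QuotientGroup.mk_inv]
      group
  · rintro x _ ⟨hx, hx'⟩
    exact ⟨by simpa using hx', by simpa using hx⟩

/-- Membership in a class `[v]` is not changed by an element of `J`. -/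
theorem mem_classJ_iff {g : MulAut F₂} (hg : g ∈ J) (u v : F₂) :
    g u ∈ classJ v ↔ u ∈ classJ v := by
  constructor
  · rintro ⟨φ, hφ, e⟩
    exact ⟨g⁻¹ * φ, J.mul_mem (J.inv_mem hg) hφ, by simp [MulAut.mul_apply, e]⟩
  · rintro ⟨φ, hφ, e⟩
    exact ⟨g * φ, J.mul_mem hg hφ, by simp [MulAut.mul_apply, e]⟩

theorem conj_mem_edgeClasses {g : MulAut F₂} (hg : g ∈ J) (w v : F₂) {c : MulAut F₂ ⧸ Inn}
    (hc : c ∈ edgeClasses w (classJ v)) :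
    (g : MulAut F₂ ⧸ Inn) * c * (g : MulAut F₂ ⧸ Inn)⁻¹ ∈ edgeClasses (g w) (classJ v) := by
  obtain ⟨φ, hφ, rfl, hw⟩ := hc
  obtain ⟨ψ, hψ, e⟩ := (oneLetter_conj_J hg).1 φ hφ
  refine ⟨ψ, hψ, e, ?_⟩
  have hi : ψ * (g * φ * g⁻¹)⁻¹ ∈ Inn := by
    rw [← QuotientGroup.eq_one_iff, QuotientGroup.mk_mul, QuotientGroup.mk_inv, e]
    simp
  have hJ : ψ * (g * φ * g⁻¹)⁻¹ ∈ J := Subgroup.subset_closure (Or.inl hi)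
  have key : ψ (g w) = (ψ * (g * φ * g⁻¹)⁻¹) (g (φ w)) := by
    simp [MulAut.mul_apply]
  rw [key, mem_classJ_iff hJ, mem_classJ_iff hg]
  exact hw

/-- The number of edges of `Γ(W)` from `[w]` to `[v]` does not depend on the representative. -/
theorem ncard_edgeClasses {w w' : F₂} (hw : w' ∈ classJ w) (v : F₂) :
    (edgeClasses w' (classJ v)).ncard = (edgeClasses w (classJ v)).ncard := by
  obtain ⟨g, hg, rfl⟩ := hw
  have : edgeClasses (g w) (classJ v) =
      (MulAut.conj (g : MulAut F₂ ⧸ Inn)) '' edgeClasses w (classJ v) := by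
    ext c
    constructor
    · intro hc
      have := conj_mem_edgeClasses (J.inv_mem hg) (g w) v hc
      rw [MulAut.inv_apply_self] at this
      refine ⟨_, this, ?_⟩
      rw [MulAut.conj_apply, QuotientGroup.mk_inv]
      group
    · rintro ⟨d, hd, rfl⟩
      exact conj_mem_edgeClasses hg w v hd
  rw [this, Set.ncard_image_of_injective _ (MulAut.conj (g : MulAut F₂ ⧸ Inn)).injective]

end FreeTwo

/-!
The function on `F₂` which is studied here is the cyclic length `cycLen`, the length of the
cyclically reduced word. It is constant on the classes of `J`, and an element is minimal iff its
length is equal to its cyclic length, which is minimal on the orbit.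

*Convexity.* By Nielsen's theorem (`genSubgroup_eq_top`), `Aut F₂` is generated by `J` and the twist
`tw 1 : b ↦ b a`. Its cosets modulo `J` are the edges of the Farey graph, whose vertices are the
primitive elements up to conjugation and inversion. Every edge lies in two triangles; the other
four edges of these triangles correspond to the twists `tw (±1)` and `tw' (±1)`. Up to `J`, every
automorphism is a path which does not turn back, that is, a product of positive twists
(`exists_posPath`). The numbers `cycCount` of letters `a^{±1}` and `b^{±1}` behave like
intersection numbers with the vertices of the Farey graph: `cycLen w` is the sum of two of them, and
they satisfy the convexity inequalities `two_mul_cycCount_zero_le` and `two_mul_cycCount_one_le`. So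
along a path which does not turn back, the length never decreases after it has failed to decrease
once. This gives Whitehead's theorem `IsLocallyMinimal.connected`: local minima are minima, and the
minimal words are connected by moves which preserve the length.

*The upper bound.* The map `k ↦ cycCount 0 (tw k w)` is a sum of terms `|m + k s|`, one for each
letter `b^{±1}` of the cyclic word, with `s = 0` between letters `b^{±1}` of opposite signs and
`s = ±1` otherwise (`exists_fan`). If no minimal word admits length-preserving moves into both of
the triangles at its edge, the minimal words belong to at most three classes, the edges of one
triangle. Suppose that such a word `w` exists. If it has as many letters `a^{±1}` as letters
`b^{±1}`, then `w` and its four neighbours represent all the classes. Otherwise, after exchanging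
`a` and `b`, the minimal words are the `tw k w` for `k` in the interval where the sum above is
minimal. There are `N` terms with `s = ±1` and `Z` terms with `s = 0`, both numbers are even, and
the terms with `s = 0` do not vanish, so this interval contains at most `n - 5` integers, unless
`N = 0`, when the twist fixes the conjugacy class, or `N = 2` and `Z = 0`, when a reflection of the
interval preserves the classes (`exists_reps_of_lt`). Each class contains at most `8 n` minimal
words, because `J` is the product of the inner automorphisms and of `8` permutations, and the
cyclically reduced conjugates of a word are its `n` rotations.

*Sharpness.* For `k + m = n - 6` the words `b a^k b a b⁻¹ a^m b⁻¹ a⁻¹` are related by the twist.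
Their images under the permutations and rotations are `8 n (n - 5)` distinct minimal words
(`exists_extremal`), which forces equality in all the bounds.
-/

namespace FreeTwo

open FreeGroup hiding map_mul map_inv map_one norm norm_eq_zero

/-! ### Cyclic letter counts -/

/-- The number of letters `i^{±1}` in the reduced word of `w`. -/
def rawCount (i : Fin 2) (w : F₂) : ℕ := w.toWord.countP (fun x => x.1 = i)

/-- The number of letters `i^{±1}` in the cyclically reduced word of `w`. -/
def cycCount (i : Fin 2) (w : F₂) : ℕ :=
  (reduceCyclically w.toWord).countP (fun x => x.1 = i)

theorem rawCount_mul_le (i : Fin 2) (x y : F₂) :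
    rawCount i (x * y) ≤ rawCount i x + rawCount i y := by
  unfold rawCount
  rw [← List.countP_append]
  exact (toWord_mul_sublist x y).countP_le

theorem countP_invRev (i : Fin 2) (L : List (Fin 2 × Bool)) :
    (invRev L).countP (fun x => x.1 = i) = L.countP (fun x => x.1 = i) := by
  simp [invRev, List.countP_map, Function.comp_def]

/-- The counts of the powers of `w` grow linearly, with the cyclic count as rate: if
`w = g u g⁻¹` with `u` cyclically reduced, then `w ^ (n + 1)` is spelled by `g u ⋯ u g⁻¹`. -/
theorem rawCount_pow_succ (i : Fin 2) (w : F₂) (n : ℕ) :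
    rawCount i (w ^ (n + 1)) =
      2 * (reduceCyclically.conjugator w.toWord).countP (fun x => x.1 = i) +
        (n + 1) * cycCount i w := by
  unfold rawCount cycCount
  rw [toWord_pow, reduceCyclically.reduce_flatten_replicate_succ isReduced_toWord]
  simp only [List.countP_append, countP_invRev, List.countP_flatten, List.map_replicate,
    List.sum_replicate, smul_eq_mul]
  ring

/-- Cyclic counts are the growth rates of the counts of the powers, so an endomorphism which
increases the counts by at most a constant cannot increase the cyclic counts. -/
theorem cycCount_le_of_rawCount_le {i j : Fin 2} (ψ : F₂ →* F₂) (C : ℕ)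
    (h : ∀ u, rawCount i (ψ u) ≤ rawCount j u + C) (w : F₂) :
    cycCount i (ψ w) ≤ cycCount j w := by
  by_contra! hlt
  set D := 2 * (reduceCyclically.conjugator w.toWord).countP (fun x => x.1 = j)
  have h1 := h (w ^ (C + D + 1))
  rw [map_pow, rawCount_pow_succ, rawCount_pow_succ] at h1
  have h2 : (C + D + 1) * (cycCount j w + 1) ≤ (C + D + 1) * cycCount i (ψ w) :=
    Nat.mul_le_mul_left _ hlt
  rw [mul_add] at h2
  change _ ≤ D + _ + C at h1
  omega

/-- Cyclic counts are invariant under conjugation, as conjugation by `g` changes the counts by a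
bounded amount. -/
theorem cycCount_conj (i : Fin 2) (g w : F₂) : cycCount i (g * w * g⁻¹) = cycCount i w := by
  have key : ∀ g w : F₂, cycCount i (g * w * g⁻¹) ≤ cycCount i w := fun g w =>
    cycCount_le_of_rawCount_le (MulAut.conj g).toMonoidHom (rawCount i g + rawCount i g⁻¹)
      (fun u => by
        have h1 := rawCount_mul_le i (g * u) g⁻¹
        have h2 := rawCount_mul_le i g u
        simp only [MulEquiv.toMonoidHom_eq_coe, MonoidHom.coe_coe, MulAut.conj_apply]
        omega) w
  refine le_antisymm (key g w) ?_
  have := key g⁻¹ (g * w * g⁻¹)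
  simpa [mul_assoc] using this

theorem cycCount_of_isConj (i : Fin 2) {v w : F₂} (h : IsConj v w) :
    cycCount i v = cycCount i w := by
  obtain ⟨g, rfl⟩ := isConj_iff.1 h
  exact (cycCount_conj i g v).symm

/-- A homomorphism which sends the generators to letters or inverses of letters, with `j` the only
generator sent to `i^{±1}`, does not increase counts. -/
theorem rawCount_map_le {i j : Fin 2} (ψ : F₂ →* F₂)
    (h : ∀ k, rawCount i (ψ (of k)) ≤ if k = j then 1 else 0) (u : F₂) :
    rawCount i (ψ u) ≤ rawCount j u := by
  have hinv : ∀ x : F₂, rawCount i x⁻¹ = rawCount i x := fun x => by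
    unfold rawCount; rw [toWord_inv, countP_invRev]
  have key : ∀ L : List (Fin 2 × Bool),
      rawCount i (ψ (mk L)) ≤ L.countP (fun x => x.1 = j) := by
    intro L
    induction L with
    | nil => simp [← one_eq_mk, rawCount]
    | cons x L ih =>
      have : (mk (x :: L) : F₂) = mk [x] * mk L := by simp [mul_mk]
      rw [this, map_mul]
      refine (rawCount_mul_le _ _ _).trans ?_
      rw [List.countP_cons]
      have h1 : rawCount i (ψ (mk [x])) ≤ if x.1 = j then 1 else 0 := by
        obtain ⟨k, t⟩ := x
        cases t
        · have e : (mk [(k, false)] : F₂) = (of k)⁻¹ := by simp [of, invRev]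
          rw [e, map_inv, hinv]; exact h k
        · exact h k
      simp only [decide_eq_true_eq]
      omega
  have := key u.toWord
  rwa [mk_toWord] at this

theorem reduceCyclically_eq_self {L : List (Fin 2 × Bool)} (h : IsCyclicallyReduced L) :
    reduceCyclically L = L := by
  induction L using List.bidirectionalRec with
  | nil => simp
  | singleton => simp
  | cons_append x l y _ =>
    rw [← List.cons_append, isCyclicallyReduced_cons_append_iff] at h
    rw [reduceCyclically.cons_append, if_neg, List.cons_append]
    · rintro ⟨h1, h2⟩
      have := h.2 h1
      rw [this] at h2
      simp at h2

theorem cycCount_mk {L : List (Fin 2 × Bool)} (h : IsCyclicallyReduced L) (i : Fin 2) :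
    cycCount i (mk L) = L.countP (fun x => x.1 = i) := by
  rw [cycCount, toWord_mk, h.isReduced.reduce_eq, reduceCyclically_eq_self h]

/-- The length of the cyclically reduced word of `w`. -/
def cycLen (w : F₂) : ℕ := cycCount 0 w + cycCount 1 w

theorem countP_zero_add_countP_one (L : List (Fin 2 × Bool)) :
    L.countP (fun x => x.1 = 0) + L.countP (fun x => x.1 = 1) = L.length := by
  induction L with
  | nil => rfl
  | cons x L ih =>
    obtain ⟨k, t⟩ := x
    rw [List.countP_cons, List.countP_cons, List.length_cons, ← ih]
    fin_cases k <;> simp <;> omega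

theorem cycLen_eq_length (w : F₂) : cycLen w = (reduceCyclically w.toWord).length :=
  countP_zero_add_countP_one _

theorem cycLen_of_isConj {v w : F₂} (h : IsConj v w) : cycLen v = cycLen w := by
  unfold cycLen
  rw [cycCount_of_isConj 0 h, cycCount_of_isConj 1 h]

theorem cycLen_le_norm (w : F₂) : cycLen w ≤ w.norm := by
  rw [cycLen_eq_length, FreeGroup.norm]
  conv_rhs => rw [← reduceCyclically.conj_conjugator_reduceCyclically w.toWord]
  simp only [List.length_append, invRev_length]
  omega

/-- Every element is conjugate to an element whose length is the cyclic length. -/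
theorem exists_isConj_norm_eq (w : F₂) : ∃ v, IsConj w v ∧ v.norm = cycLen w := by
  refine ⟨mk (reduceCyclically w.toWord), ?_, ?_⟩
  · refine IsConj.symm (isConj_iff.2 ⟨mk (reduceCyclically.conjugator w.toWord), ?_⟩)
    rw [inv_mk, mul_mk, mul_mk, reduceCyclically.conj_conjugator_reduceCyclically, mk_toWord]
  · rw [FreeGroup.norm, toWord_mk, cycLen_eq_length,
      (reduceCyclically.isCyclicallyReduced isReduced_toWord).isReduced.reduce_eq]

/-- An element is spelled by a cyclically reduced word if it is a shortest one in its conjugacy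
class. -/
theorem isCyclicallyReduced_of_norm_eq {w : F₂} (h : w.norm = cycLen w) :
    IsCyclicallyReduced w.toWord := by
  have h1 := reduceCyclically.conj_conjugator_reduceCyclically w.toWord
  have h2 := congrArg List.length h1
  rw [FreeGroup.norm, cycLen_eq_length] at h
  simp only [List.length_append, invRev_length] at h2
  have h3 : reduceCyclically.conjugator w.toWord = [] := List.length_eq_zero_iff.1 (by omega)
  rw [h3] at h1
  simp only [List.nil_append, invRev_empty, List.append_nil] at h1
  rw [← h1]
  exact reduceCyclically.isCyclicallyReduced isReduced_toWord

theorem cycLen_mk {L : List (Fin 2 × Bool)} (h : IsCyclicallyReduced L) :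
    cycLen (mk L) = L.length := by
  rw [cycLen_eq_length, toWord_mk, h.isReduced.reduce_eq, reduceCyclically_eq_self h]

/-! ### Generators of the automorphism group -/

/-- The endomorphism with `a ↦ x`, `b ↦ y`. -/
def homOf (x y : F₂) : F₂ →* F₂ := FreeGroup.lift ![x, y]

@[simp] theorem homOf_a (x y : F₂) : homOf x y a = x := by simp [homOf, a]

@[simp] theorem homOf_b (x y : F₂) : homOf x y b = y := by simp [homOf, b]

theorem hom_ext {f g : F₂ →* F₂} (ha : f a = g a) (hb : f b = g b) : f = g := by
  refine FreeGroup.ext_hom _ _ fun i => ?_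
  fin_cases i
  · exact ha
  · exact hb

theorem aut_ext {φ ψ : MulAut F₂} (ha : φ a = ψ a) (hb : φ b = ψ b) : φ = ψ := by
  have : φ.toMonoidHom = ψ.toMonoidHom := hom_ext ha hb
  exact MulEquiv.toMonoidHom_injective this

/-- The automorphism exchanging `a` and `b`. -/
def swap : MulAut F₂ :=
  MonoidHom.toMulEquiv (homOf b a) (homOf b a)
    (hom_ext (by simp) (by simp)) (hom_ext (by simp) (by simp))

/-- The automorphism with `a ↦ a`, `b ↦ b⁻¹`. -/
def flip : MulAut F₂ :=
  MonoidHom.toMulEquiv (homOf a b⁻¹) (homOf a b⁻¹)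
    (hom_ext (by simp) (by simp)) (hom_ext (by simp) (by simp))

/-- The twist `a ↦ a`, `b ↦ b a ^ k`. -/
def tw (k : ℤ) : MulAut F₂ :=
  MonoidHom.toMulEquiv (homOf a (b * a ^ k)) (homOf a (b * a ^ (-k)))
    (hom_ext (by simp) (by simp)) (hom_ext (by simp) (by simp))

/-- The twist `b ↦ b`, `a ↦ a b ^ k`. -/
def tw' (k : ℤ) : MulAut F₂ := swap * tw k * swap

@[simp] theorem swap_a : swap a = b := homOf_a b a
@[simp] theorem swap_b : swap b = a := homOf_b b a
@[simp] theorem flip_a : flip a = a := homOf_a a b⁻¹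
@[simp] theorem flip_b : flip b = b⁻¹ := homOf_b a b⁻¹
@[simp] theorem tw_a (k : ℤ) : tw k a = a := homOf_a a (b * a ^ k)
@[simp] theorem tw_b (k : ℤ) : tw k b = b * a ^ k := homOf_b a (b * a ^ k)
@[simp] theorem tw'_a (k : ℤ) : tw' k a = a * b ^ k := by simp [tw']
@[simp] theorem tw'_b (k : ℤ) : tw' k b = b := by simp [tw']

theorem swap_mul_swap : swap * swap = 1 := aut_ext (by simp) (by simp)

theorem flip_mul_flip : flip * flip = 1 := aut_ext (by simp) (by simp)

theorem tw_add (j k : ℤ) : tw (j + k) = tw j * tw k :=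
  aut_ext (by simp) (by simp [mul_assoc, zpow_add])

theorem tw_zero : tw 0 = 1 := aut_ext (by simp) (by simp)

theorem tw_tw (j k : ℤ) (w : F₂) : tw j (tw k w) = tw (j + k) w := by rw [tw_add]; rfl

@[simp] theorem swap_swap (w : F₂) : swap (swap w) = w := DFunLike.congr_fun swap_mul_swap w

@[simp] theorem flip_flip (w : F₂) : flip (flip w) = w := DFunLike.congr_fun flip_mul_flip w

theorem tw'_tw' (j k : ℤ) (w : F₂) : tw' j (tw' k w) = tw' (j + k) w := by
  simp [tw', tw_tw]

theorem swap_tw (k : ℤ) (w : F₂) : swap (tw k w) = tw' k (swap w) := by simp [tw']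

theorem swap_tw' (k : ℤ) (w : F₂) : swap (tw' k w) = tw k (swap w) := by simp [tw']

theorem flip_tw' (k : ℤ) (w : F₂) : flip (tw' k w) = tw' (-k) (flip w) := by
  have : flip * tw' k = tw' (-k) * flip := aut_ext (by simp) (by simp)
  exact DFunLike.congr_fun this w

theorem flip_tw (k : ℤ) (w : F₂) :
    flip (tw k w) = a ^ (-k) * tw (-k) (flip w) * (a ^ (-k))⁻¹ := by
  have : flip * tw k = MulAut.conj (a ^ (-k)) * (tw (-k) * flip) := by
    refine aut_ext ?_ ?_
    · change flip (tw k a) = a ^ (-k) * tw (-k) (flip a) * (a ^ (-k))⁻¹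
      simp only [tw_a, flip_a]
      group
    · change flip (tw k b) = a ^ (-k) * tw (-k) (flip b) * (a ^ (-k))⁻¹
      simp only [tw_b, flip_b, flip_a, map_mul, map_inv, map_zpow]
      group
  exact DFunLike.congr_fun this w

/-- Two edges of the Farey graph in a triangle with a third one: up to `J`, the neighbours `tw' 1 w`
and `tw 1 w` of `w` are neighbours of each other. -/
theorem tw_neg_one_tw' (w : F₂) :
    tw (-1) (tw' 1 w) = a * swap (flip (tw 1 w)) * a⁻¹ := by
  have : tw (-1) * tw' 1 = MulAut.conj a * (swap * (flip * tw 1)) :=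
    aut_ext (by simp [mul_assoc]) (by simp)
  exact DFunLike.congr_fun this w

/-! ### The group `J` -/

theorem conj_mem_J (g : F₂) : MulAut.conj g ∈ J :=
  Subgroup.subset_closure (Or.inl ⟨g, rfl⟩)

theorem swap_mem_J : swap ∈ J := by
  refine Subgroup.subset_closure (Or.inr ?_)
  simp [IsPermutation, letters, Set.image_insert_eq]
  ext; simp; tauto

theorem flip_mem_J : flip ∈ J := by
  refine Subgroup.subset_closure (Or.inr ?_)
  simp [IsPermutation, letters, Set.image_insert_eq]
  ext; simp; tauto

theorem ne_letters : a ≠ b ∧ a ≠ a⁻¹ ∧ a ≠ b⁻¹ ∧ b ≠ a⁻¹ ∧ b ≠ b⁻¹ := by decide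

/-- The eight permutations. -/
theorem isPermutation_cases {π : MulAut F₂} (h : IsPermutation π) :
    ∃ i j k : ℕ, π = swap ^ i * flip ^ j * (swap * flip * swap) ^ k ∧ i < 2 ∧ j < 2 ∧ k < 2 := by
  have hm : ∀ z ∈ letters, π z ∈ letters := fun z hz => h ▸ Set.mem_image_of_mem π hz
  have ha := hm a (by simp [letters])
  have hb := hm b (by simp [letters])
  have h1 : π a ≠ π b := π.injective.ne ne_letters.1
  have h2 : π a ≠ (π b)⁻¹ := by rw [← map_inv]; exact π.injective.ne ne_letters.2.2.1
  simp only [letters, Set.mem_insert_iff, Set.mem_singleton_iff] at ha hb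
  rcases ha with ha | ha | ha | ha <;> rcases hb with hb | hb | hb | hb <;>
    first
    | (exfalso; rw [ha, hb] at h1 h2; simp at h1 h2; done)
    | refine ⟨0, 0, 0, aut_ext ?_ ?_, by norm_num⟩ <;> (simp [ha, hb]; done)
    | refine ⟨0, 0, 1, aut_ext ?_ ?_, by norm_num⟩ <;> (simp [ha, hb]; done)
    | refine ⟨0, 1, 0, aut_ext ?_ ?_, by norm_num⟩ <;> (simp [ha, hb]; done)
    | refine ⟨0, 1, 1, aut_ext ?_ ?_, by norm_num⟩ <;> (simp [ha, hb]; done)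
    | refine ⟨1, 0, 0, aut_ext ?_ ?_, by norm_num⟩ <;> (simp [ha, hb]; done)
    | refine ⟨1, 0, 1, aut_ext ?_ ?_, by norm_num⟩ <;> (simp [ha, hb]; done)
    | refine ⟨1, 1, 0, aut_ext ?_ ?_, by norm_num⟩ <;> (simp [ha, hb]; done)
    | refine ⟨1, 1, 1, aut_ext ?_ ?_, by norm_num⟩ <;> simp [ha, hb]

/-- Induction over `J`: it is generated as a monoid by the inner automorphisms, `swap` and
`flip`. -/
theorem J_induction {P : MulAut F₂ → Prop} (one : P 1)
    (conj : ∀ g φ, P φ → P (MulAut.conj g * φ)) (sw : ∀ φ, P φ → P (swap * φ))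
    (fl : ∀ φ, P φ → P (flip * φ)) {φ : MulAut F₂} (hφ : φ ∈ J) : P φ := by
  have key : (∀ ψ, P ψ → P (φ * ψ)) ∧ (∀ ψ, P ψ → P (φ⁻¹ * ψ)) := by
    refine Subgroup.closure_induction (p := fun φ _ =>
      (∀ ψ, P ψ → P (φ * ψ)) ∧ (∀ ψ, P ψ → P (φ⁻¹ * ψ))) ?_ ?_ ?_ ?_ hφ
    · rintro x (⟨g, rfl⟩ | hx)
      · exact ⟨fun ψ hψ => conj g ψ hψ, fun ψ hψ => by rw [← map_inv]; exact conj _ ψ hψ⟩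
      · have aux : ∀ i j k : ℕ, ∀ ψ, P ψ →
            P (swap ^ i * flip ^ j * (swap * flip * swap) ^ k * ψ) := by
          intro i j k ψ hψ
          have h1 : ∀ ψ, P ψ → P ((swap * flip * swap) ^ k * ψ) := by
            induction k with
            | zero => simp
            | succ k ih =>
              intro ψ hψ
              rw [pow_succ, mul_assoc, mul_assoc, mul_assoc]
              exact ih _ (sw _ (fl _ (sw _ hψ)))
          have h2 : ∀ ψ, P ψ → P (flip ^ j * ψ) := by
            induction j with
            | zero => simp
            | succ j ih =>
              intro ψ hψ
              rw [pow_succ, mul_assoc]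
              exact ih _ (fl _ hψ)
          have h3 : ∀ ψ, P ψ → P (swap ^ i * ψ) := by
            induction i with
            | zero => simp
            | succ j ih =>
              intro ψ hψ
              rw [pow_succ, mul_assoc]
              exact ih _ (sw _ hψ)
          rw [mul_assoc, mul_assoc]
          exact h3 _ (h2 _ (h1 _ hψ))
        obtain ⟨i, j, k, e, -⟩ := isPermutation_cases hx
        obtain ⟨i', j', k', e', -⟩ := isPermutation_cases (isPermutation_inv hx)
        exact ⟨e ▸ aux i j k, e' ▸ aux i' j' k'⟩
    · simp
    · rintro x y _ _ ⟨hx, hx'⟩ ⟨hy, hy'⟩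
      refine ⟨fun ψ hψ => ?_, fun ψ hψ => ?_⟩
      · rw [mul_assoc]; exact hx _ (hy _ hψ)
      · rw [mul_inv_rev, mul_assoc]; exact hy' _ (hx' _ hψ)
    · rintro x _ ⟨hx, hx'⟩
      exact ⟨hx', by simpa using hx⟩
  simpa using key.1 1 one

theorem cycCount_flip (i : Fin 2) (w : F₂) : cycCount i (flip w) = cycCount i w := by
  have key : ∀ w : F₂, cycCount i (flip w) ≤ cycCount i w := fun w =>
    cycCount_le_of_rawCount_le flip.toMonoidHom 0 (fun u => by
      refine rawCount_map_le _ (fun k => ?_) u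
      fin_cases k <;> fin_cases i <;> decide) w
  exact le_antisymm (key w) (by simpa using key (flip w))

theorem cycCount_zero_swap (w : F₂) : cycCount 0 (swap w) = cycCount 1 w := by
  have key : ∀ i : Fin 2, ∀ w : F₂, cycCount i (swap w) ≤ cycCount (1 - i) w := fun i w =>
    cycCount_le_of_rawCount_le swap.toMonoidHom 0 (fun u => by
      refine rawCount_map_le _ (fun k => ?_) u
      fin_cases k <;> fin_cases i <;> decide) w
  exact le_antisymm (key 0 w) (by simpa using key 1 (swap w))

theorem cycCount_one_swap (w : F₂) : cycCount 1 (swap w) = cycCount 0 w := by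
  rw [← cycCount_zero_swap, swap_swap]

/-- The cyclic length depends only on the `J`-class. -/
theorem cycLen_J {φ : MulAut F₂} (hφ : φ ∈ J) (w : F₂) : cycLen (φ w) = cycLen w := by
  refine J_induction (P := fun φ => cycLen (φ w) = cycLen w) rfl ?_ ?_ ?_ hφ
  · intro g φ h
    rw [MulAut.mul_apply, MulAut.conj_apply, ← h]
    exact (cycLen_of_isConj (isConj_iff.2 ⟨g, rfl⟩)).symm
  · intro φ h
    rw [MulAut.mul_apply, cycLen, cycCount_zero_swap, cycCount_one_swap, add_comm]
    exact h
  · intro φ h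
    rw [MulAut.mul_apply, cycLen, cycCount_flip, cycCount_flip]
    exact h

/-- Two elements in the same `J`-orbit. -/
def RelJ (v w : F₂) : Prop := ∃ φ ∈ J, φ v = w

theorem RelJ.refl (v : F₂) : RelJ v v := ⟨1, J.one_mem, rfl⟩

theorem RelJ.symm {v w : F₂} (h : RelJ v w) : RelJ w v := by
  obtain ⟨φ, hφ, rfl⟩ := h
  exact ⟨φ⁻¹, J.inv_mem hφ, by simp⟩

theorem RelJ.trans {u v w : F₂} (h : RelJ u v) (h' : RelJ v w) : RelJ u w := by
  obtain ⟨φ, hφ, rfl⟩ := h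
  obtain ⟨ψ, hψ, rfl⟩ := h'
  exact ⟨ψ * φ, J.mul_mem hψ hφ, rfl⟩

theorem RelJ.of_isConj {v w : F₂} (h : IsConj v w) : RelJ v w := by
  obtain ⟨g, rfl⟩ := isConj_iff.1 h
  exact ⟨MulAut.conj g, conj_mem_J g, rfl⟩

theorem relJ_swap (v : F₂) : RelJ v (swap v) := ⟨swap, swap_mem_J, rfl⟩

theorem relJ_flip (v : F₂) : RelJ v (flip v) := ⟨flip, flip_mem_J, rfl⟩

theorem relJ_conj (g v : F₂) : RelJ v (g * v * g⁻¹) := ⟨MulAut.conj g, conj_mem_J g, rfl⟩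

theorem RelJ.cycLen_eq {v w : F₂} (h : RelJ v w) : cycLen v = cycLen w := by
  obtain ⟨φ, hφ, rfl⟩ := h
  exact (cycLen_J hφ v).symm

theorem RelJ.classJ_eq {v w : F₂} (h : RelJ v w) : classJ v = classJ w :=
  Set.ext fun _ => ⟨fun hu => h.symm.trans hu, fun hu => h.trans hu⟩

/-- The elements of `J` permute the four neighbours of an edge of the Farey graph. -/
theorem relJ_moves {φ : MulAut F₂} (hφ : φ ∈ J) (w : F₂) :
    ∀ k : ℤ, k = 1 ∨ k = -1 → (RelJ (tw k (φ w)) (tw 1 w) ∨ RelJ (tw k (φ w)) (tw (-1) w) ∨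
      RelJ (tw k (φ w)) (tw' 1 w) ∨ RelJ (tw k (φ w)) (tw' (-1) w)) ∧
      (RelJ (tw' k (φ w)) (tw 1 w) ∨ RelJ (tw' k (φ w)) (tw (-1) w) ∨
      RelJ (tw' k (φ w)) (tw' 1 w) ∨ RelJ (tw' k (φ w)) (tw' (-1) w)) := by
  have tr : ∀ {u v p q r s : F₂}, RelJ u v → (RelJ v p ∨ RelJ v q ∨ RelJ v r ∨ RelJ v s) →
      (RelJ u p ∨ RelJ u q ∨ RelJ u r ∨ RelJ u s) := by
    rintro u v p q r s h (h' | h' | h' | h')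
    exacts [Or.inl (h.trans h'), Or.inr (Or.inl (h.trans h')),
      Or.inr (Or.inr (Or.inl (h.trans h'))), Or.inr (Or.inr (Or.inr (h.trans h')))]
  refine J_induction (P := fun φ => ∀ k : ℤ, k = 1 ∨ k = -1 → (RelJ (tw k (φ w)) (tw 1 w) ∨
    RelJ (tw k (φ w)) (tw (-1) w) ∨
      RelJ (tw k (φ w)) (tw' 1 w) ∨ RelJ (tw k (φ w)) (tw' (-1) w)) ∧
      (RelJ (tw' k (φ w)) (tw 1 w) ∨ RelJ (tw' k (φ w)) (tw (-1) w) ∨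
      RelJ (tw' k (φ w)) (tw' 1 w) ∨ RelJ (tw' k (φ w)) (tw' (-1) w))) ?_ ?_ ?_ ?_ hφ
  · rintro k (rfl | rfl) <;> simp [RelJ.refl]
  · intro g φ h k hk
    rw [MulAut.mul_apply, MulAut.conj_apply]
    refine ⟨tr ?_ (h k hk).1, tr ?_ (h k hk).2⟩
    · rw [map_mul, map_mul, map_inv]; exact (relJ_conj _ _).symm
    · rw [map_mul, map_mul, map_inv]; exact (relJ_conj _ _).symm
  · intro φ h k hk
    rw [MulAut.mul_apply]
    refine ⟨tr ?_ (h k hk).2, tr ?_ (h k hk).1⟩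
    · rw [← swap_tw']; exact (relJ_swap _).symm
    · rw [← swap_tw]; exact (relJ_swap _).symm
  · intro φ h k hk
    rw [MulAut.mul_apply]
    have hk' : -k = 1 ∨ -k = -1 := by omega
    refine ⟨tr ?_ (h (-k) hk').1, tr ?_ (h (-k) hk').2⟩
    · have := flip_tw (-k) (φ w)
      rw [neg_neg] at this
      exact ((relJ_flip _).trans (this ▸ (relJ_conj _ _).symm)).symm
    · rw [← neg_neg k, ← flip_tw', neg_neg]; exact (relJ_flip _).symm

/-! ### The tree metric of the free group -/

/-- The length of the longest common prefix of two words. -/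
def lcp : List (Fin 2 × Bool) → List (Fin 2 × Bool) → ℕ
  | x :: L, y :: M => if x = y then lcp L M + 1 else 0
  | _, _ => 0

theorem lcp_comm : ∀ L M, lcp L M = lcp M L
  | [], [] => rfl
  | [], _ :: _ => rfl
  | _ :: _, [] => rfl
  | x :: L, y :: M => by simp only [lcp, lcp_comm L M, eq_comm]

/-- The ultrametric inequality, which makes the free group `0`-hyperbolic. -/
theorem min_lcp_le : ∀ L M K, min (lcp L M) (lcp M K) ≤ lcp L K
  | [], _, _ => by simp [lcp]
  | _ :: _, [], _ => by simp [lcp]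
  | _ :: _, _ :: _, [] => by simp [lcp]
  | x :: L, y :: M, z :: K => by
    have := min_lcp_le L M K
    simp only [lcp]
    split_ifs with h1 h2 h3 h3 <;> simp_all

theorem take_lcp : ∀ L M : List (Fin 2 × Bool), L.take (lcp L M) = M.take (lcp L M)
  | [], [] => rfl
  | [], _ :: _ => rfl
  | _ :: _, [] => rfl
  | x :: L, y :: M => by
    simp only [lcp]
    split_ifs with h
    · simp [h, take_lcp L M]
    · rfl

theorem isReduced_invRev {L : List (Fin 2 × Bool)} (h : FreeGroup.IsReduced L) :
    FreeGroup.IsReduced (invRev L) := by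
  rw [isReduced_iff_reduce_eq] at h ⊢
  rw [reduce_invRev, h]

theorem norm_mk_of_isReduced {L : List (Fin 2 × Bool)} (h : FreeGroup.IsReduced L) :
    (mk L : F₂).norm = L.length := by
  rw [FreeGroup.norm, toWord_mk, h.reduce_eq]

theorem norm_inv_mul_mk_add : ∀ {L M : List (Fin 2 × Bool)}, FreeGroup.IsReduced L →
    FreeGroup.IsReduced M →
    ((mk L)⁻¹ * mk M : F₂).norm + 2 * lcp L M = L.length + M.length
  | [], M, _, hM => by
    have : (mk [] : F₂) = 1 := one_eq_mk.symm
    simp [this, lcp, norm_mk_of_isReduced hM]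
  | x :: L, [], hL, _ => by
    have : (mk [] : F₂) = 1 := one_eq_mk.symm
    rw [this, mul_one, norm_inv_eq, norm_mk_of_isReduced hL]
    simp [lcp]
  | x :: L, y :: M, hL, hM => by
    by_cases h : x = y
    · subst h
      have h1 : (mk (x :: L) : F₂) = mk [x] * mk L := by simp [mul_mk]
      have h2 : (mk (x :: M) : F₂) = mk [x] * mk M := by simp [mul_mk]
      have e : ((mk (x :: L))⁻¹ * mk (x :: M) : F₂) = (mk L)⁻¹ * mk M := by
        rw [h1, h2]; group
      have := norm_inv_mul_mk_add (L := L) (M := M) (hL.infix ⟨[x], [], by simp⟩)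
        (hM.infix ⟨[x], [], by simp⟩)
      rw [e]
      simp only [lcp, if_true, List.length_cons]
      omega
    · have hr : FreeGroup.IsReduced (invRev (x :: L) ++ (y :: M)) := by
        have hL' := isReduced_invRev hL
        unfold FreeGroup.IsReduced at hL' hM ⊢
        rw [List.isChain_append]
        refine ⟨hL', hM, ?_⟩
        intro u hu v hv
        rw [invRev_cons] at hu
        simp [invRev] at hu hv
        subst hu hv
        intro h1
        by_contra h2
        apply h
        ext1
        · exact h1
        · simpa using h2
      rw [inv_mk, mul_mk, norm_mk_of_isReduced hr]
      simp [lcp, h]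

/-- The longest common prefix is the part which cancels in `x⁻¹ * y`. -/
theorem norm_inv_mul_add (x y : F₂) :
    (x⁻¹ * y).norm + 2 * lcp x.toWord y.toWord = x.norm + y.norm := by
  have := norm_inv_mul_mk_add (isReduced_toWord (x := x)) (isReduced_toWord (x := y))
  rwa [mk_toWord, mk_toWord] at this

theorem norm_mul_add (x y : F₂) :
    (x * y).norm + 2 * lcp x⁻¹.toWord y.toWord = x.norm + y.norm := by
  have := norm_inv_mul_add x⁻¹ y
  rwa [inv_inv, norm_inv_eq] at this

/-- The four-point condition of a tree for the points `g⁻¹, 1, x, x * y`. -/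
theorem norm_mul_mul_add {g x y : F₂} (h : g.norm + y.norm < (g * x).norm + (x * y).norm) :
    (g * x * y).norm + x.norm = (g * x).norm + (x * y).norm := by
  have h1 := norm_mul_add g x
  have h2 := norm_inv_mul_add x (x * y)
  have h3 := norm_mul_add g (x * y)
  rw [inv_mul_cancel_left] at h2
  rw [← mul_assoc] at h3
  have u1 := min_lcp_le g⁻¹.toWord x.toWord (x * y).toWord
  have u2 := min_lcp_le g⁻¹.toWord (x * y).toWord x.toWord
  rw [lcp_comm (x * y).toWord] at u2
  omega

theorem norm_eq_rawCount (w : F₂) : w.norm = rawCount 0 w + rawCount 1 w :=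
  (countP_zero_add_countP_one _).symm

theorem cycLen_pos {w : F₂} (h : w ≠ 1) : 0 < cycLen w := by
  obtain ⟨v, hv, e⟩ := exists_isConj_norm_eq w
  rw [← e, Nat.pos_iff_ne_zero, Ne, FreeGroup.norm_eq_zero]
  rintro rfl
  exact h (isConj_one_left.1 hv)

theorem norm_lt_norm_mul_self {w : F₂} (h : w ≠ 1) : w.norm < (w * w).norm := by
  have h1 := cycLen_pos h
  have h20 := rawCount_pow_succ 0 w 1
  have h21 := rawCount_pow_succ 1 w 1
  have h10 := rawCount_pow_succ 0 w 0
  have h11 := rawCount_pow_succ 1 w 0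
  simp only [zero_add, pow_one] at h10 h11
  have e : w ^ (1 + 1) = w * w := by rw [one_add_one_eq_two, sq]
  rw [e] at h20 h21
  rw [norm_eq_rawCount, norm_eq_rawCount, h20, h21, h10, h11]
  unfold cycLen at h1
  omega

/-! ### Generation of the automorphism group -/

/-- If half of `y` cancels on both sides of the product `x y x`, then a conjugation makes the pair
`(x y, y)` short. -/
theorem exists_conj_norm_le {x y : F₂} (h1 : (x * y).norm = x.norm) (h2 : (y * x).norm = x.norm)
    (h3 : y.norm ≤ x.norm) : ∃ q : F₂, (q⁻¹ * y * q).norm ≤ y.norm ∧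
      (q⁻¹ * (x * y) * q).norm + y.norm ≤ x.norm := by
  have e1 := norm_mul_add x y
  have e2 := norm_mul_add y x
  set h := lcp y⁻¹.toWord x.toWord with hh
  have eh : lcp x⁻¹.toWord y.toWord = h := by omega
  have t1 := take_lcp y⁻¹.toWord x.toWord
  have t2 := take_lcp x⁻¹.toWord y.toWord
  rw [eh] at t2
  rw [← hh] at t1
  set Q := x.toWord.take h with hQ
  set X := x.toWord.drop h with hX
  set Y := y⁻¹.toWord.drop h with hY
  have hx : x.toWord = Q ++ X := (List.take_append_drop h _).symm
  have hy : y⁻¹.toWord = Q ++ Y := by rw [← t1, hY]; exact (List.take_append_drop h _).symm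
  have lx : x.toWord.length = x.norm := rfl
  have ly : y⁻¹.toWord.length = y.norm := norm_inv_eq
  have lQ : Q.length = h := by rw [hQ, List.length_take]; omega
  have lX : X.length + h = x.norm := by rw [hX, List.length_drop]; omega
  have lY : Y.length = h := by rw [hY, List.length_drop]; omega
  have hy' : y.toWord = invRev Y ++ invRev Q := by
    rw [← invRev_append, ← hy, ← toWord_inv, inv_inv]
  rw [toWord_inv, hx, hy', invRev_append, List.take_append_of_le_length (by simp; omega),
    List.take_append_of_le_length (by simp; omega), List.take_of_length_le (l := invRev Y)
    (by simp; omega)] at t2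
  have hX' : X = invRev ((invRev X).drop h) ++ Y := by
    have := (List.take_append_drop h (invRev X)).symm
    rw [t2] at this
    have := congrArg invRev this
    rwa [invRev_append, invRev_invRev, invRev_invRev] at this
  set M := invRev ((invRev X).drop h) with hM
  have lM : M.length + h = X.length := by
    have := congrArg List.length hX'
    rw [List.length_append] at this; omega
  have gx : x = mk Q * (mk M * mk Y) := by
    rw [mul_mk, ← hX', mul_mk, ← hx, mk_toWord]
  have gy : y = (mk Y)⁻¹ * (mk Q)⁻¹ := by
    rw [← mul_inv_rev, mul_mk, ← hy, mk_toWord, inv_inv]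
  have nQ : (mk Q : F₂).norm ≤ h := lQ ▸ norm_mk_le
  have nY : (mk Y : F₂).norm ≤ h := lY ▸ norm_mk_le
  have nM : (mk M : F₂).norm ≤ M.length := norm_mk_le
  refine ⟨mk Q, ?_, ?_⟩
  · have : (mk Q : F₂)⁻¹ * y * mk Q = (mk Q)⁻¹ * (mk Y)⁻¹ := by rw [gy]; group
    rw [this]
    refine (FreeGroup.norm_mul_le _ _).trans ?_
    rw [norm_inv_eq, norm_inv_eq]
    omega
  · have : (mk Q : F₂)⁻¹ * (x * y) * mk Q = mk M := by
      nth_rw 1 [gx, gy]; group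
    rw [this]
    omega

/-- The letter with the given code. -/
def letter (x : Fin 2 × Bool) : F₂ := mk [x]

theorem letter_inv (i : Fin 2) (t : Bool) : (letter (i, t))⁻¹ = letter (i, !t) := by
  simp [letter, inv_mk, invRev]

/-- Permutations of the letters act transitively on the bases which consist of letters. -/
theorem exists_J_letter {x y : Fin 2 × Bool} (h : x.1 ≠ y.1) :
    ∃ π ∈ J, π a = letter x ∧ π b = letter y := by
  have ea : letter (0, true) = a := rfl
  have eb : letter (1, true) = b := rfl
  have ea' : letter (0, false) = a⁻¹ := by rw [← ea, letter_inv]; rfl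
  have eb' : letter (1, false) = b⁻¹ := by rw [← eb, letter_inv]; rfl
  have s := swap_mem_J
  have f := flip_mem_J
  have g := J.mul_mem (J.mul_mem s f) s
  obtain ⟨i, t⟩ := x
  obtain ⟨j, u⟩ := y
  fin_cases i <;> fin_cases j <;> first | (exfalso; exact h rfl) | skip
  · cases t <;> cases u
    · exact ⟨_, J.mul_mem f g, by simp [ea'], by simp [eb']⟩
    · exact ⟨_, g, by simp [ea'], by simp [eb]⟩
    · exact ⟨_, f, by simp [ea], by simp [eb']⟩
    · exact ⟨_, J.one_mem, by simp [ea], by simp [eb]⟩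
  · cases t <;> cases u
    · exact ⟨_, J.mul_mem s (J.mul_mem f g), by simp [eb'], by simp [ea']⟩
    · exact ⟨_, J.mul_mem s g, by simp [eb'], by simp [ea]⟩
    · exact ⟨_, J.mul_mem s f, by simp [eb], by simp [ea']⟩
    · exact ⟨_, s, by simp [eb], by simp [ea]⟩

/-- The subgroup generated by `J` and the twist `b ↦ b a`. -/
def genSubgroup : Subgroup (MulAut F₂) := J ⊔ Subgroup.zpowers (tw 1)

theorem J_le_genSubgroup : J ≤ genSubgroup := le_sup_left

theorem tw_one_mem : tw 1 ∈ genSubgroup :=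
  (le_sup_right : _ ≤ genSubgroup) (Subgroup.mem_zpowers _)

theorem tw'_one_mem : tw' 1 ∈ genSubgroup :=
  mul_mem (mul_mem (J_le_genSubgroup swap_mem_J) tw_one_mem) (J_le_genSubgroup swap_mem_J)

/-- The basis `χ a, χ b` is shortest among the bases which are obtained from it by the generating
automorphisms. -/
def IsShortBasis (χ : MulAut F₂) : Prop :=
  ∀ τ ∈ genSubgroup, (χ a).norm + (χ b).norm ≤ (χ (τ a)).norm + (χ (τ b)).norm

namespace IsShortBasis

variable {χ : MulAut F₂}

/-- Shortness is a symmetric condition on the letters: it is preserved by permutations. -/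
theorem mul_J (h : IsShortBasis χ) {π : MulAut F₂} (hπ : π ∈ J)
    {x y : Fin 2 × Bool} (hx : π a = letter x) (hy : π b = letter y) (hxy : x.1 ≠ y.1) :
    IsShortBasis (χ * π) := by
  intro τ hτ
  have key := h (π * τ) (mul_mem (J_le_genSubgroup hπ) hτ)
  refine le_trans (le_of_eq ?_) key
  have hl : ∀ i t, (χ (letter (i, t))).norm = (χ (letter (i, true))).norm := by
    rintro i (_ | _)
    · rw [← Bool.not_true, ← letter_inv, map_inv, norm_inv_eq]
    · rfl
  obtain ⟨i, t⟩ := x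
  obtain ⟨j, u⟩ := y
  rw [MulAut.mul_apply, MulAut.mul_apply, hx, hy, hl, hl j]
  have ea : a = letter (0, true) := rfl
  have eb : b = letter (1, true) := rfl
  rw [ea, eb]
  fin_cases i <;> fin_cases j <;> first | (exfalso; exact hxy rfl) | skip
  · rfl
  · exact add_comm _ _

theorem norm_le_mul (h : IsShortBasis χ) {x y : Fin 2 × Bool} (hxy : x.1 ≠ y.1) :
    (χ (letter x)).norm ≤ (χ (letter x) * χ (letter y)).norm ∧
    (χ (letter y)).norm ≤ (χ (letter x) * χ (letter y)).norm := by
  have key : ∀ {x y : Fin 2 × Bool}, x.1 ≠ y.1 →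
      (χ (letter x)).norm ≤ (χ (letter x) * χ (letter y)).norm := by
    intro x y hxy
    obtain ⟨π, hπ, hx, hy⟩ := exists_J_letter hxy
    have := h.mul_J hπ hx hy hxy (tw' 1) tw'_one_mem
    simp only [tw'_a, tw'_b, zpow_one, map_mul, MulAut.mul_apply, hx, hy] at this
    omega
  refine ⟨key hxy, ?_⟩
  obtain ⟨i, t⟩ := x
  obtain ⟨j, u⟩ := y
  have := key (x := (j, !u)) (y := (i, !t)) hxy.symm
  rwa [← letter_inv, ← letter_inv, map_inv, map_inv, ← mul_inv_rev, norm_inv_eq,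
    norm_inv_eq] at this

theorem letter_ne_one (x : Fin 2 × Bool) : χ (letter x) ≠ 1 := by
  intro h
  rw [map_eq_one_iff _ χ.injective] at h
  have := congrArg FreeGroup.norm h
  simp [letter, FreeGroup.norm] at this

/-- In a short basis, the letter `y` is not cancelled half from the left and half from the right
by the same letter `x`: otherwise a conjugation would shorten the basis `x y, y`. -/
theorem not_half_cancel (h : IsShortBasis χ) {x y : Fin 2 × Bool} (hxy : x.1 ≠ y.1)
    (h1 : (χ (letter x) * χ (letter y)).norm = (χ (letter x)).norm)
    (h2 : (χ (letter y) * χ (letter x)).norm = (χ (letter x)).norm) : False := by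
  obtain ⟨q, hq1, hq2⟩ := exists_conj_norm_le h1 h2 (h1 ▸ (h.norm_le_mul hxy).2)
  obtain ⟨π, hπ, hx, hy⟩ := exists_J_letter hxy
  have key := h.mul_J hπ hx hy hxy (MulAut.conj ((χ * π)⁻¹ q⁻¹) * tw' 1)
    (mul_mem (J_le_genSubgroup (conj_mem_J _)) tw'_one_mem)
  have ev : ∀ z, (χ * π) ((MulAut.conj ((χ * π)⁻¹ q⁻¹) * tw' 1) z) =
      q⁻¹ * χ (π (tw' 1 z)) * q := by
    intro z
    change (χ * π) ((χ * π)⁻¹ q⁻¹ * tw' 1 z * ((χ * π)⁻¹ q⁻¹)⁻¹) = _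
    simp only [map_mul, map_inv, MulAut.apply_inv_self, inv_inv]
    rfl
  rw [ev a, ev b] at key
  simp only [tw'_a, tw'_b, zpow_one, map_mul, MulAut.mul_apply, hx, hy] at key
  have h0 : 0 < (χ (letter y)).norm := by
    rw [Nat.pos_iff_ne_zero, Ne, FreeGroup.norm_eq_zero]
    exact letter_ne_one y
  omega

/-- Less than the whole middle letter cancels in a product of three letters. -/
theorem add_lt_add (h : IsShortBasis χ) {x y z : Fin 2 × Bool} (hxy : x.1 = y.1 → x.2 = y.2)
    (hyz : y.1 = z.1 → y.2 = z.2) :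
    (χ (letter x)).norm + (χ (letter z)).norm <
      (χ (letter x) * χ (letter y)).norm + (χ (letter y) * χ (letter z)).norm := by
  have sq : ∀ x, (χ (letter x)).norm < (χ (letter x) * χ (letter x)).norm := fun x =>
    norm_lt_norm_mul_self (letter_ne_one x)
  by_cases e1 : x.1 = y.1
  · have : x = y := Prod.ext e1 (hxy e1)
    subst this
    by_cases e2 : x.1 = z.1
    · have : x = z := Prod.ext e2 (hyz e2)
      subst this
      exact Nat.add_lt_add (sq x) (sq x)
    · exact Nat.add_lt_add_of_lt_of_le (sq x) (h.norm_le_mul e2).2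
  by_cases e2 : y.1 = z.1
  · have : y = z := Prod.ext e2 (hyz e2)
    subst this
    exact Nat.add_lt_add_of_le_of_lt (h.norm_le_mul e1).1 (sq y)
  have e3 : x.1 = z.1 := by omega
  have g1 := (h.norm_le_mul e1).1
  have g2 := (h.norm_le_mul e2).2
  by_contra hcon
  have g3 : (χ (letter x) * χ (letter y)).norm = (χ (letter x)).norm := by omega
  have g4 : (χ (letter y) * χ (letter z)).norm = (χ (letter z)).norm := by omega
  by_cases e4 : x.2 = z.2
  · have : x = z := Prod.ext e3 e4
    subst this
    exact h.not_half_cancel e1 g3 g4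
  · have ez : χ (letter z) = (χ (letter x))⁻¹ := by
      obtain ⟨i, t⟩ := x
      obtain ⟨j, u⟩ := z
      rw [← map_inv, letter_inv]
      simp only at e3 e4
      subst e3
      congr 3
      cases t <;> cases u <;> simp_all
    rw [ez, norm_inv_eq] at g4
    set u := χ (letter x)
    set v := χ (letter y)
    have c1 := norm_mul_add u v
    have c2 := norm_mul_add v u⁻¹
    have c3 := norm_mul_add v v
    have c4 := min_lcp_le v⁻¹.toWord u⁻¹.toWord v.toWord
    have c5 : v.norm < (v * v).norm := sq y
    rw [norm_inv_eq] at c2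
    omega

/-- In a short basis, cancellation in the image of a reduced word occurs only between the images of
adjacent letters, so the length is a sum over the pairs of adjacent letters. -/
theorem norm_mk_cons_cons (h : IsShortBasis χ) : ∀ {x y : Fin 2 × Bool} {L : List (Fin 2 × Bool)},
    FreeGroup.IsReduced (x :: y :: L) →
    (χ (mk (x :: y :: L))).norm + (χ (letter y)).norm =
      (χ (letter x) * χ (letter y)).norm + (χ (mk (y :: L))).norm
  | x, y, [], _ => by
    rw [← map_mul]
    simp [letter, mul_mk]
  | x, y, z :: L, hr => by
    have hc : ∀ (x : Fin 2 × Bool) (L), χ (mk (x :: L)) = χ (letter x) * χ (mk L) := by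
      intro x L
      rw [← map_mul]
      simp [letter, mul_mk]
    rw [isReduced_cons_cons] at hr
    have ih := h.norm_mk_cons_cons hr.2
    have hyz := hr.2
    rw [isReduced_cons_cons] at hyz
    have lt := h.add_lt_add hr.1 hyz.1
    rw [hc y] at ih
    have key := norm_mul_mul_add (g := χ (letter x)) (x := χ (letter y)) (y := χ (mk (z :: L)))
      (by omega)
    rw [hc x, hc y, ← mul_assoc]
    exact key

theorem norm_le_mul_of_isReduced (h : IsShortBasis χ) {x y : Fin 2 × Bool}
    (hxy : x.1 = y.1 → x.2 = y.2) :
    (χ (letter x)).norm ≤ (χ (letter x) * χ (letter y)).norm ∧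
    (χ (letter y)).norm ≤ (χ (letter x) * χ (letter y)).norm := by
  by_cases e1 : x.1 = y.1
  · have : x = y := Prod.ext e1 (hxy e1)
    subst this
    have := (norm_lt_norm_mul_self (letter_ne_one (χ := χ) x)).le
    exact ⟨this, this⟩
  · exact h.norm_le_mul e1

theorem two_le_norm (h : IsShortBasis χ) : ∀ {x y : Fin 2 × Bool} {L : List (Fin 2 × Bool)},
    FreeGroup.IsReduced (x :: y :: L) → 2 ≤ (χ (mk (x :: y :: L))).norm
  | x, y, [], hr => by
    have e : χ (mk [x, y]) = χ (letter x) * χ (letter y) := by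
      rw [← map_mul]; simp [letter, mul_mk]
    rw [isReduced_cons_cons] at hr
    obtain ⟨h1, h2⟩ := h.norm_le_mul_of_isReduced hr.1
    have h3 := norm_mul_add (χ (letter x)) (χ (letter y))
    have h4 : (χ (letter x)).norm ≠ 0 := by rw [Ne, FreeGroup.norm_eq_zero]; exact letter_ne_one x
    have h5 : (χ (letter y)).norm ≠ 0 := by rw [Ne, FreeGroup.norm_eq_zero]; exact letter_ne_one y
    rw [e]
    omega
  | x, y, z :: L, hr => by
    have h1 := h.norm_mk_cons_cons hr
    rw [isReduced_cons_cons] at hr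
    have h2 := h.two_le_norm hr.2
    have h3 := (h.norm_le_mul_of_isReduced hr.1).2
    omega

theorem exists_eq_letter (h : IsShortBasis χ) {w : F₂} (hw : w.norm = 1) :
    ∃ x, χ (letter x) = w := by
  have hr : FreeGroup.IsReduced (χ⁻¹ w).toWord := isReduced_toWord
  have e : χ (mk (χ⁻¹ w).toWord) = w := by rw [mk_toWord]; simp
  match hL : (χ⁻¹ w).toWord with
  | [] =>
    rw [hL, ← one_eq_mk, map_one] at e
    rw [← e] at hw
    simp at hw
  | [x] => exact ⟨x, by rw [hL] at e; exact e⟩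
  | x :: y :: L =>
    rw [hL] at e hr
    have := h.two_le_norm hr
    rw [e] at this
    omega

/-- A short basis consists of letters, because the letters `a` and `b` are images of words of
length one. -/
theorem mem_J (h : IsShortBasis χ) : χ ∈ J := by
  obtain ⟨x, hx⟩ := h.exists_eq_letter (w := a) (by simp [a])
  obtain ⟨y, hy⟩ := h.exists_eq_letter (w := b) (by simp [b])
  have hxy : x.1 ≠ y.1 := by
    intro e
    obtain ⟨i, t⟩ := x
    obtain ⟨j, u⟩ := y
    simp only at e
    subst e
    by_cases e' : t = u
    · subst e'
      exact ne_letters.1 (hx.symm.trans hy)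
    · have : letter (i, u) = (letter (i, t))⁻¹ := by
        rw [letter_inv]; cases t <;> cases u <;> simp_all
      rw [this, map_inv, hx] at hy
      exact ne_letters.2.2.2.1 hy.symm
  obtain ⟨π, hπ, ha, hb⟩ := exists_J_letter hxy
  have : χ * π = 1 := aut_ext (by simp [ha, hx]) (by simp [hb, hy])
  rw [mul_eq_one_iff_eq_inv.1 this]
  exact J.inv_mem hπ

end IsShortBasis

/-- **Nielsen's theorem** in rank two: `J` and the twist `b ↦ b a` generate the automorphism group,
since a shortest basis in each coset consists of letters. -/
theorem genSubgroup_eq_top : genSubgroup = ⊤ := by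
  rw [eq_top_iff]
  intro φ _
  let S : Set ℕ := {m | ∃ τ ∈ genSubgroup, m = (φ (τ a)).norm + (φ (τ b)).norm}
  have hS : S.Nonempty := ⟨_, 1, one_mem _, rfl⟩
  obtain ⟨τ, hτ, e⟩ := Nat.sInf_mem hS
  have hs : IsShortBasis (φ * τ) := by
    intro σ hσ
    have : (φ ((τ * σ) a)).norm + (φ ((τ * σ) b)).norm ∈ S := ⟨_, mul_mem hτ hσ, rfl⟩
    have := Nat.sInf_le this
    rw [e] at this
    exact this
  have := mul_mem (J_le_genSubgroup hs.mem_J) (inv_mem hτ)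
  rwa [mul_inv_cancel_right] at this

/-! ### Syllables -/

/-- The product of the syllables `b^{±1} a ^ m`; the sign of `b` is coded by a Boolean. -/
def syl : List (Bool × ℤ) → F₂
  | [] => 1
  | (e, m) :: L => letter (1, e) * a ^ m * syl L

/-- The sign of the first syllable of a list, or `e₀` if the list is empty. For a cyclic list `e₀`
is the sign of the first syllable of the whole list. -/
def nextSign : List (Bool × ℤ) → Bool → Bool
  | [], e₀ => e₀
  | (e, _) :: _, _ => e

theorem nextSign_nil (e₀ : Bool) : nextSign [] e₀ = e₀ := rfl

theorem nextSign_cons (e : Bool) (m : ℤ) (L : List (Bool × ℤ)) (e₀ : Bool) :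
    nextSign ((e, m) :: L) e₀ = e := rfl

/-- The change of the exponent of `a` between the letters `b^e` and `b^{e'}` under the twist
`b ↦ b a`. -/
def slope (e e' : Bool) : ℤ := if e = e' then (if e then 1 else -1) else 0

/-- The list of the pairs (slope, exponent) of the syllables. -/
def terms : List (Bool × ℤ) → Bool → List (ℤ × ℤ)
  | [], _ => []
  | (e, m) :: L, e₀ => (slope e (nextSign L e₀), m) :: terms L e₀

/-- The effect of `tw k` on the syllables. -/
def twist (k : ℤ) : List (Bool × ℤ) → Bool → List (Bool × ℤ)
  | [], _ => []
  | (e, m) :: L, e₀ => (e, m + k * slope e (nextSign L e₀)) :: twist k L e₀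

/-- No cancellation occurs in the word spelled by the syllables, followed by `b^{e₀}`. -/
def IsGood (L : List (Bool × ℤ)) (e₀ : Bool) : Prop := ∀ t ∈ terms L e₀, t.1 = 0 → t.2 ≠ 0

theorem syl_append (L M : List (Bool × ℤ)) : syl (L ++ M) = syl L * syl M := by
  induction L with
  | nil => simp [syl]
  | cons x L ih => simp [syl, ih, mul_assoc]

theorem nextSign_twist (k : ℤ) (L : List (Bool × ℤ)) (e₀ : Bool) :
    nextSign (twist k L e₀) e₀ = nextSign L e₀ := by
  cases L <;> rfl

theorem length_twist (k : ℤ) (L : List (Bool × ℤ)) (e₀ : Bool) :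
    (twist k L e₀).length = L.length := by
  induction L with
  | nil => rfl
  | cons x L ih => simp [twist, ih]

theorem terms_twist (k : ℤ) (L : List (Bool × ℤ)) (e₀ : Bool) :
    terms (twist k L e₀) e₀ = (terms L e₀).map (fun t => (t.1, t.2 + k * t.1)) := by
  induction L with
  | nil => rfl
  | cons x L ih => simp [twist, terms, nextSign_twist, ih]

theorem IsGood.twist {L : List (Bool × ℤ)} {e₀ : Bool} (h : IsGood L e₀) (k : ℤ) :
    IsGood (twist k L e₀) e₀ := by
  intro t ht h0
  rw [terms_twist, List.mem_map] at ht
  obtain ⟨s, hs, rfl⟩ := ht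
  simp only at h0 ⊢
  simpa [h0] using h s hs h0

theorem tw_letter (k : ℤ) (e : Bool) :
    tw k (letter (1, e)) =
      a ^ (-(if e then 0 else k)) * letter (1, e) * a ^ (if e then k else 0) := by
  have eb : letter (1, true) = b := rfl
  have eb' : letter (1, false) = b⁻¹ := by rw [← eb, letter_inv]; rfl
  cases e <;> simp [eb, eb']

/-- The twist acts syllable by syllable, up to a power of `a` at either end. -/
theorem tw_syl (k : ℤ) (L : List (Bool × ℤ)) (e₀ : Bool) :
    tw k (syl L) = a ^ (-(if nextSign L e₀ then 0 else k)) * syl (twist k L e₀) *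
      a ^ (if e₀ then 0 else k) := by
  induction L with
  | nil => cases e₀ <;> simp [syl, twist, nextSign_nil]
  | cons x L ih =>
    obtain ⟨e, m⟩ := x
    have : (if e then k else 0) + m + -(if nextSign L e₀ then 0 else k) =
        m + k * slope e (nextSign L e₀) := by
      unfold slope
      cases e <;> cases nextSign L e₀ <;> (simp; try ring)
    simp only [syl, twist, map_mul, map_zpow, tw_a, tw_letter, ih]
    rw [← this, zpow_add, zpow_add]
    simp only [mul_assoc, nextSign_cons]
    rfl

theorem isConj_tw_syl (k : ℤ) {L : List (Bool × ℤ)} {e₀ : Bool} (h : nextSign L e₀ = e₀) :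
    IsConj (tw k (syl L)) (syl (twist k L e₀)) := by
  refine IsConj.symm (isConj_iff.2 ⟨a ^ (-(if e₀ then 0 else k)), ?_⟩)
  rw [tw_syl k L e₀, h, zpow_neg, inv_inv]

/-- The word in letters spelled by the syllables. -/
def sylWord : List (Bool × ℤ) → List (Fin 2 × Bool)
  | [] => []
  | (e, m) :: L => (1, e) :: (List.replicate m.natAbs (0, decide (0 ≤ m)) ++ sylWord L)

theorem mk_replicate (m : ℤ) :
    (mk (List.replicate m.natAbs (0, decide (0 ≤ m))) : F₂) = a ^ m := by
  have key : ∀ (n : ℕ) (t : Bool), (mk (List.replicate n (0, t)) : F₂) = letter (0, t) ^ n := by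
    intro n t
    rw [letter, pow_mk]
    congr 1
    simp
  have ea : letter (0, true) = a := rfl
  have ea' : letter (0, false) = a⁻¹ := by rw [← ea, letter_inv]; rfl
  rw [key]
  obtain ⟨n, rfl | rfl⟩ := m.eq_nat_or_neg
  · simp [ea]
  · rcases Nat.eq_zero_or_pos n with rfl | hn
    · simp
    · have : decide (0 ≤ -(n : ℤ)) = false := by simp; omega
      rw [this, ea']
      simp

theorem mk_sylWord (L : List (Bool × ℤ)) : mk (sylWord L) = syl L := by
  induction L with
  | nil => exact one_eq_mk.symm
  | cons x L ih =>
    obtain ⟨e, m⟩ := x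
    rw [sylWord, syl, ← ih, ← mk_replicate, letter, mul_mk, mul_mk]
    simp

theorem isReduced_block {e e' s : Bool} {k : ℕ} {R : List (Fin 2 × Bool)}
    (hR : FreeGroup.IsReduced R) (hh : R.head? = some (1, e')) (h : e ≠ e' → k ≠ 0) :
    FreeGroup.IsReduced ((1, e) :: (List.replicate k (0, s) ++ R)) := by
  obtain ⟨y, R, rfl⟩ : ∃ y R', R = y :: R' := by
    cases R with
    | nil => simp at hh
    | cons y R => exact ⟨y, R, rfl⟩
  simp only [List.head?_cons, Option.some.injEq] at hh
  subst hh
  have key : ∀ k : ℕ,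
      FreeGroup.IsReduced (List.replicate (k + 1) ((0 : Fin 2), s) ++ (1, e') :: R) := by
    intro k
    induction k with
    | zero =>
      simp only [zero_add, List.replicate_one, List.singleton_append]
      rw [isReduced_cons_cons]
      exact ⟨by simp, hR⟩
    | succ k ih =>
      rw [List.replicate_succ, List.replicate_succ, List.cons_append, List.cons_append,
        isReduced_cons_cons]
      exact ⟨by simp, by rwa [List.replicate_succ, List.cons_append] at ih⟩
  cases k with
  | zero =>
    simp only [List.replicate_zero, List.nil_append]
    rw [isReduced_cons_cons]
    refine ⟨fun _ => ?_, hR⟩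
    by_contra hne
    exact h hne rfl
  | succ k =>
    have := key k
    rw [List.replicate_succ, List.cons_append] at this ⊢
    rw [isReduced_cons_cons]
    exact ⟨by simp, this⟩

theorem head?_sylWord_append (L : List (Bool × ℤ)) (e₀ : Bool) :
    (sylWord L ++ [(1, e₀)]).head? = some (1, nextSign L e₀) := by
  cases L <;> simp [sylWord, nextSign]

theorem IsGood.isReduced {L : List (Bool × ℤ)} {e₀ : Bool} (h : IsGood L e₀) :
    FreeGroup.IsReduced (sylWord L ++ [(1, e₀)]) := by
  induction L with
  | nil => simp [sylWord]
  | cons x L ih =>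
    obtain ⟨e, m⟩ := x
    rw [sylWord, List.cons_append, List.append_assoc]
    refine isReduced_block (ih fun t ht => h t (List.mem_cons_of_mem _ ht))
      (head?_sylWord_append L e₀) fun hne => ?_
    have := h (slope e (nextSign L e₀), m) List.mem_cons_self (by simp [slope, hne])
    simpa using this

theorem IsGood.isCyclicallyReduced {L : List (Bool × ℤ)} {e₀ : Bool} (h : IsGood L e₀)
    (h0 : nextSign L e₀ = e₀) : IsCyclicallyReduced (sylWord L) := by
  have hr := h.isReduced
  refine ⟨hr.infix ⟨[], [(1, e₀)], by simp⟩, fun x hx y hy => ?_⟩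
  cases L with
  | nil => simp [sylWord] at hx
  | cons z L =>
    obtain ⟨e, m⟩ := z
    simp only [nextSign] at h0
    subst h0
    simp only [sylWord, List.head?_cons, Option.mem_def, Option.some.injEq] at hy
    subst hy
    unfold FreeGroup.IsReduced at hr
    rw [List.isChain_append] at hr
    exact hr.2.2 x hx _ (by simp)

theorem countP_one_sylWord (L : List (Bool × ℤ)) :
    (sylWord L).countP (fun x => x.1 = 1) = L.length := by
  induction L with
  | nil => rfl
  | cons x L ih =>
    obtain ⟨e, m⟩ := x
    simp only [sylWord, List.countP_cons, List.countP_append, ih, List.countP_replicate]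
    simp

theorem countP_zero_sylWord (L : List (Bool × ℤ)) (e₀ : Bool) :
    ((sylWord L).countP (fun x => x.1 = 0) : ℤ) = ((terms L e₀).map (fun t => |t.2|)).sum := by
  induction L with
  | nil => rfl
  | cons x L ih =>
    obtain ⟨e, m⟩ := x
    simp only [sylWord, List.countP_cons, List.countP_append, List.countP_replicate, terms,
      List.map_cons, List.sum_cons, ← ih]
    simp

theorem IsGood.cycCount_one {L : List (Bool × ℤ)} {e₀ : Bool} (h : IsGood L e₀)
    (h0 : nextSign L e₀ = e₀) : cycCount 1 (syl L) = L.length := by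
  rw [← mk_sylWord, cycCount_mk (h.isCyclicallyReduced h0), countP_one_sylWord]

theorem IsGood.cycCount_zero {L : List (Bool × ℤ)} {e₀ : Bool} (h : IsGood L e₀)
    (h0 : nextSign L e₀ = e₀) :
    (cycCount 0 (syl L) : ℤ) = ((terms L e₀).map (fun t => |t.2|)).sum := by
  rw [← mk_sylWord, cycCount_mk (h.isCyclicallyReduced h0), countP_zero_sylWord]

theorem IsGood.cycCount_one_tw {L : List (Bool × ℤ)} {e₀ : Bool} (h : IsGood L e₀)
    (h0 : nextSign L e₀ = e₀) (k : ℤ) : cycCount 1 (tw k (syl L)) = L.length := by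
  rw [cycCount_of_isConj 1 (isConj_tw_syl k h0),
    (h.twist k).cycCount_one (by rw [nextSign_twist, h0]), length_twist]

theorem IsGood.cycCount_zero_tw {L : List (Bool × ℤ)} {e₀ : Bool} (h : IsGood L e₀)
    (h0 : nextSign L e₀ = e₀) (k : ℤ) :
    (cycCount 0 (tw k (syl L)) : ℤ) = ((terms L e₀).map (fun t => |t.2 + k * t.1|)).sum := by
  rw [cycCount_of_isConj 0 (isConj_tw_syl k h0),
    (h.twist k).cycCount_zero (by rw [nextSign_twist, h0]), terms_twist, List.map_map]
  rfl

theorem exists_eq_zpow_mul_syl (w : F₂) : ∃ (m : ℤ) (L : List (Bool × ℤ)), w = a ^ m * syl L := by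
  have key : ∀ W : List (Fin 2 × Bool), ∃ (m : ℤ) (L : List (Bool × ℤ)),
      (mk W : F₂) = a ^ m * syl L := by
    intro W
    induction W with
    | nil => exact ⟨0, [], by simp [syl, ← one_eq_mk]⟩
    | cons x W ih =>
      obtain ⟨m, L, ih⟩ := ih
      have hc : (mk (x :: W) : F₂) = letter x * mk W := by simp [letter, mul_mk]
      obtain ⟨i, t⟩ := x
      fin_cases i
      · cases t
        · refine ⟨-1 + m, L, ?_⟩
          have : letter (0, false) = a⁻¹ := by
            rw [← Bool.not_true, ← letter_inv]; rfl
          rw [hc, ih, zpow_add, zpow_neg_one, ← this, mul_assoc]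
          rfl
        · refine ⟨1 + m, L, ?_⟩
          rw [hc, ih, zpow_add, zpow_one, ← mul_assoc]
          rfl
      · refine ⟨0, (t, m) :: L, ?_⟩
        rw [hc, ih, zpow_zero, one_mul, syl, ← mul_assoc]
        rfl
  simpa [mk_toWord] using key w.toWord

theorem exists_syl_mul_zpow {L : List (Bool × ℤ)} (hL : L ≠ []) (m : ℤ) :
    ∃ M : List (Bool × ℤ), M.length = L.length ∧ syl M = syl L * a ^ m := by
  induction L with
  | nil => exact absurd rfl hL
  | cons x L ih =>
    obtain ⟨e, k⟩ := x
    by_cases h : L = []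
    · subst h
      exact ⟨[(e, k + m)], rfl, by simp [syl, zpow_add, mul_assoc]⟩
    · obtain ⟨M, h1, h2⟩ := ih h
      exact ⟨(e, k) :: M, by simp [h1], by simp [syl, h2, mul_assoc]⟩

/-- Where a product of syllables cancels, `b^e a^0 b^{-e}` occurs in it. -/
theorem exists_bad {L : List (Bool × ℤ)} {e₀ : Bool} (h : ¬ IsGood L e₀) :
    ∃ L₁ e L₂, L = L₁ ++ (e, 0) :: L₂ ∧ nextSign L₂ e₀ = !e := by
  induction L with
  | nil => exact absurd (fun t ht => by simp [terms] at ht) h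
  | cons x L ih =>
    obtain ⟨e, m⟩ := x
    by_cases hL : IsGood L e₀
    · have : slope e (nextSign L e₀) = 0 ∧ m = 0 := by
        by_contra hcon
        apply h
        intro t ht h0
        rcases List.mem_cons.1 ht with rfl | ht
        · exact fun h1 => hcon ⟨h0, h1⟩
        · exact hL t ht h0
      refine ⟨[], e, L, by simp [this.2], ?_⟩
      have h1 := this.1
      unfold slope at h1
      cases e <;> cases hn : nextSign L e₀ <;> simp_all
    · obtain ⟨L₁, e', L₂, rfl, h2⟩ := ih hL
      exact ⟨(e, m) :: L₁, e', L₂, by simp, h2⟩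

/-- Every element is conjugate to a power of `a` or to a cyclically reduced product of
syllables. -/
theorem exists_isConj_syl (w : F₂) : (∃ m : ℤ, IsConj w (a ^ m)) ∨
    ∃ L e₀, nextSign L e₀ = e₀ ∧ IsGood L e₀ ∧ IsConj w (syl L) := by
  have swp : ∀ x y : F₂, IsConj (x * y) (y * x) := fun x y =>
    isConj_iff.2 ⟨x⁻¹, by group⟩
  have key : ∀ (n : ℕ) (L : List (Bool × ℤ)), L.length = n → ∀ m : ℤ,
      (∃ m' : ℤ, IsConj (syl L * a ^ m) (a ^ m')) ∨
      ∃ M e₀, nextSign M e₀ = e₀ ∧ IsGood M e₀ ∧ IsConj (syl L * a ^ m) (syl M) := by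
    intro n
    induction n using Nat.strong_induction_on with
    | _ n ih =>
      intro L hn m
      by_cases hL : L = []
      · subst hL
        exact Or.inl ⟨m, by rw [show syl [] = 1 from rfl, one_mul]⟩
      obtain ⟨M, hM, e⟩ := exists_syl_mul_zpow hL m
      rw [← e]
      obtain ⟨x, M', rfl⟩ : ∃ x M', M = x :: M' := by
        cases M with
        | nil => exact absurd (List.length_eq_zero_iff.1 hM.symm) hL
        | cons x M' => exact ⟨x, M', rfl⟩
      by_cases hg : IsGood (x :: M') x.1
      · exact Or.inr ⟨x :: M', x.1, rfl, hg, IsConj.refl _⟩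
      obtain ⟨L₁, e, L₂, h1, h2⟩ := exists_bad hg
      obtain ⟨m', R, hR⟩ : ∃ m' R, L₂ ++ L₁ = (!e, m') :: R := by
        cases L₂ with
        | nil =>
          simp only [nextSign] at h2
          cases L₁ with
          | nil =>
            simp only [List.nil_append, List.cons.injEq] at h1
            rw [h1.1] at h2
            simp at h2
          | cons y L₁ =>
            simp only [List.cons_append, List.cons.injEq] at h1
            refine ⟨y.2, L₁, ?_⟩
            rw [← h2, h1.1]
            rfl
        | cons y L₂ =>
          simp only [nextSign] at h2
          refine ⟨y.2, L₂ ++ L₁, ?_⟩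
          rw [← h2]
          rfl
      have c : IsConj (syl (x :: M')) (syl R * a ^ m') := by
        rw [h1, syl_append]
        refine (swp _ _).trans ?_
        have : syl ((e, 0) :: L₂) * syl L₁ = a ^ m' * syl R := by
          rw [syl, mul_assoc, ← syl_append, hR, syl, ← letter_inv]
          group
        rw [this]
        exact swp _ _
      have hlen : R.length < n := by
        have e1 := congrArg List.length h1
        have e2 := congrArg List.length hR
        simp only [List.length_append, List.length_cons] at e1 e2 hM
        omega
      rcases ih _ hlen R rfl m' with ⟨k, hk⟩ | ⟨M, e₀, h1, h2, h3⟩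
      · exact Or.inl ⟨k, c.trans hk⟩
      · exact Or.inr ⟨M, e₀, h1, h2, c.trans h3⟩
  obtain ⟨m, L, rfl⟩ := exists_eq_zpow_mul_syl w
  rcases key _ L rfl m with ⟨k, hk⟩ | ⟨M, e₀, h1, h2, h3⟩
  · exact Or.inl ⟨k, (swp _ _).trans hk⟩
  · exact Or.inr ⟨M, e₀, h1, h2, (swp _ _).trans h3⟩

/-! ### Length along the powers of a twist -/

theorem slope_mem (e e' : Bool) : slope e e' = 0 ∨ slope e e' = 1 ∨ slope e e' = -1 := by
  cases e <;> cases e' <;> decide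

theorem slope_of_mem_terms {L : List (Bool × ℤ)} {e₀ : Bool} {t : ℤ × ℤ} (h : t ∈ terms L e₀) :
    t.1 = 0 ∨ t.1 = 1 ∨ t.1 = -1 := by
  induction L with
  | nil => simp [terms] at h
  | cons x L ih =>
    rcases List.mem_cons.1 h with rfl | h
    · exact slope_mem _ _
    · exact ih h

theorem length_terms (L : List (Bool × ℤ)) (e₀ : Bool) : (terms L e₀).length = L.length := by
  induction L with
  | nil => rfl
  | cons x L ih => simp [terms, ih]

/-- The number of sign changes is even iff the first sign is equal to the sign `e₀` at the end. -/
theorem even_countP_terms (L : List (Bool × ℤ)) (e₀ : Bool) :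
    Even ((terms L e₀).countP (fun t => t.1 = 0)) ↔ nextSign L e₀ = e₀ := by
  induction L with
  | nil => simp [terms, nextSign]
  | cons x L ih =>
    obtain ⟨e, m⟩ := x
    rw [terms, List.countP_cons]
    simp only [slope, nextSign_cons]
    cases e <;> cases hn : nextSign L e₀ <;> cases e₀ <;> simp_all [Nat.even_add_one]

/-- A term of slope `±1` has values at `k₀` and `k₁` which differ by `k₁ - k₀`, so their absolute
values add up to at least `k₁ - k₀`; a term of slope `0` has absolute value at least `1`. -/
theorem sum_abs_add_sum_abs_ge {T : List (ℤ × ℤ)}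
    (h : ∀ t ∈ T, (t.1 = 0 ∨ t.1 = 1 ∨ t.1 = -1) ∧ (t.1 = 0 → t.2 ≠ 0)) {k₀ k₁ : ℤ}
    (hk : k₀ ≤ k₁) :
    (T.countP (fun t => t.1 ≠ 0) : ℤ) * (k₁ - k₀) + 2 * T.countP (fun t => t.1 = 0) ≤
      (T.map (fun t => |t.2 + k₀ * t.1|)).sum + (T.map (fun t => |t.2 + k₁ * t.1|)).sum := by
  induction T with
  | nil => simp
  | cons t T ih =>
    have ih := ih fun t ht => h t (List.mem_cons_of_mem _ ht)
    obtain ⟨h1, h2⟩ := h t List.mem_cons_self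
    simp only [List.countP_cons, List.map_cons, List.sum_cons]
    push_cast
    generalize T.countP (fun t => decide (t.1 ≠ 0)) = c at ih ⊢
    generalize T.countP (fun t => decide (t.1 = 0)) = d at ih ⊢
    rcases h1 with h1 | h1 | h1
    · have := h2 h1
      simp only [h1]
      norm_num
      have := abs_pos.2 this
      linarith
    · simp only [h1]
      norm_num
      rcases abs_cases (t.2 + k₀) with h | h <;> rcases abs_cases (t.2 + k₁) with h' | h' <;>
        linarith
    · simp only [h1]
      norm_num
      rcases abs_cases (t.2 + -k₀) with h | h <;> rcases abs_cases (t.2 + -k₁) with h' | h' <;>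
        linarith

theorem two_mul_sum_abs_le (T : List (ℤ × ℤ)) (k : ℤ) :
    2 * (T.map (fun t => |t.2 + k * t.1|)).sum ≤ (T.map (fun t => |t.2 + (k - 1) * t.1|)).sum +
      (T.map (fun t => |t.2 + (k + 1) * t.1|)).sum := by
  induction T with
  | nil => simp
  | cons t T ih =>
    simp only [List.map_cons, List.sum_cons]
    have e : 2 * |t.2 + k * t.1| ≤ |t.2 + (k - 1) * t.1| + |t.2 + (k + 1) * t.1| := by
      have := abs_add_le (t.2 + (k - 1) * t.1) (t.2 + (k + 1) * t.1)
      rw [show t.2 + (k - 1) * t.1 + (t.2 + (k + 1) * t.1) = 2 * (t.2 + k * t.1) by ring, abs_mul]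
        at this
      simpa using this
    linarith

theorem even_sum_abs {T : List (ℤ × ℤ)} (h : ∀ t ∈ T, t.1 = 0 ∨ t.1 = 1 ∨ t.1 = -1) (k : ℤ) :
    Even ((T.map (fun t => |t.2 + (k + 1) * t.1|)).sum + (T.map (fun t => |t.2 + k * t.1|)).sum +
      T.countP (fun t => t.1 ≠ 0)) := by
  induction T with
  | nil => simp
  | cons t T ih =>
    have ih := ih fun t ht => h t (List.mem_cons_of_mem _ ht)
    simp only [List.countP_cons, List.map_cons, List.sum_cons]
    push_cast
    generalize T.countP (fun t => decide (t.1 ≠ 0)) = c at ih ⊢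
    rw [Int.even_iff] at ih ⊢
    have h1 := h t List.mem_cons_self
    have p : ∀ x : ℤ, |x| % 2 = x % 2 := fun x => by
      rcases abs_cases x with h | h <;> omega
    have p1 := p (t.2 + (k + 1) * t.1)
    have p2 := p (t.2 + k * t.1)
    rcases h1 with h1 | h1 | h1 <;> simp only [h1] at p1 p2 ⊢ <;> norm_num at p1 p2 ⊢ <;> omega

theorem twist_eq_self {L : List (Bool × ℤ)} {e₀ : Bool} (h : ∀ t ∈ terms L e₀, t.1 = 0) (k : ℤ) :
    twist k L e₀ = L := by
  induction L with
  | nil => rfl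
  | cons x L ih =>
    obtain ⟨e, m⟩ := x
    rw [twist, ih fun t ht => h t (List.mem_cons_of_mem _ ht)]
    have : slope e (nextSign L e₀) = 0 := h (slope e (nextSign L e₀), m) List.mem_cons_self
    simp [this]

theorem isConj_tw {v w : F₂} (h : IsConj v w) (k : ℤ) : IsConj (tw k v) (tw k w) := by
  obtain ⟨g, rfl⟩ := isConj_iff.1 h
  exact isConj_iff.2 ⟨tw k g, by simp⟩

/-- The symmetry of the cyclic word `b^e a^x b^e a^y`: inverting `a` and rotating. -/
theorem relJ_tw_pair (e : Bool) (x y : ℤ) :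
    RelJ (syl [(e, x), (e, y)]) (syl [(e, -y), (e, -x)]) := by
  have hl : ∀ e, (swap (flip (swap (letter (1, e))))) = letter (1, e) := by
    have eb : letter (1, true) = b := rfl
    have eb' : letter (1, false) = b⁻¹ := by rw [← eb, letter_inv]; rfl
    intro e
    cases e <;> simp [eb, eb']
  have h1 : RelJ (syl [(e, x), (e, y)]) (syl [(e, -x), (e, -y)]) := by
    refine ⟨swap * (flip * swap), J.mul_mem swap_mem_J (J.mul_mem flip_mem_J swap_mem_J), ?_⟩
    simp only [syl, MulAut.mul_apply, map_mul, map_zpow, hl]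
    simp
  refine h1.trans (RelJ.of_isConj ?_)
  refine isConj_iff.2 ⟨(letter (1, e) * a ^ (-x))⁻¹, ?_⟩
  simp only [syl]
  group

/-- The behaviour of the letter counts along the powers of the twist `b ↦ b a`. Here `N` and `Z`
are the numbers of letters `b^{±1}` which are followed, in the cyclic order of the letters
`b^{±1}`, by a letter of the same and of the opposite sign. Between letters `b^{±1}` of opposite
signs the exponent of `a` is constant and nonzero; between letters of the same sign it changes by
`±1` with each twist. -/
theorem exists_fan (w : F₂) : ∃ N Z : ℕ, cycCount 1 w = N + Z ∧ Even Z ∧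
    (∀ k₀ k₁ : ℤ, k₀ ≤ k₁ →
      N * (k₁ - k₀) + 2 * Z ≤ (cycCount 0 (tw k₀ w) : ℤ) + cycCount 0 (tw k₁ w)) ∧
    (∀ k : ℤ, Even ((cycCount 0 (tw (k + 1) w) : ℤ) + cycCount 0 (tw k w) + N)) ∧
    (N = 0 → ∀ k : ℤ, IsConj (tw k w) w) ∧
    (N = 2 → Z = 0 → ∃ p q : ℤ, (∀ k, (cycCount 0 (tw k w) : ℤ) = |k - p| + |k - q|) ∧
      ∀ k, RelJ (tw k w) (tw (p + q - k) w)) := by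
  rcases exists_isConj_syl w with ⟨m, hm⟩ | ⟨L, e₀, h0, hg, hc⟩
  · have c1 : cycCount 1 w = 0 := by
      rw [cycCount_of_isConj 1 hm, ← mk_replicate, cycCount_mk]
      · simp
      · refine ⟨List.isChain_replicate_of_rel _ (by simp), fun x hx y hy _ => ?_⟩
        have h1 := List.eq_of_mem_replicate (List.mem_of_getLast? hx)
        have h2 := List.eq_of_mem_replicate (List.mem_of_head? hy)
        rw [h1, h2]
    have ct : ∀ k : ℤ, IsConj (tw k w) w := fun k => by
      refine (isConj_tw hm k).trans ?_
      rw [map_zpow, tw_a]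
      exact hm.symm
    refine ⟨0, 0, by simpa using c1, by simp, by intros; simp; positivity, fun k => ?_,
      fun _ => ct, by simp⟩
    rw [cycCount_of_isConj 0 (ct k), cycCount_of_isConj 0 (ct (k + 1))]
    simp
  · have hA : ∀ k, (cycCount 0 (tw k w) : ℤ) =
        ((terms L e₀).map (fun t => |t.2 + k * t.1|)).sum := fun k => by
      rw [cycCount_of_isConj 0 (isConj_tw hc k), hg.cycCount_zero_tw h0]
    have ht : ∀ t ∈ terms L e₀, (t.1 = 0 ∨ t.1 = 1 ∨ t.1 = -1) ∧ (t.1 = 0 → t.2 ≠ 0) :=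
      fun t ht => ⟨slope_of_mem_terms ht, hg t ht⟩
    have hlen : (terms L e₀).length = (terms L e₀).countP (fun t => t.1 ≠ 0) +
        (terms L e₀).countP (fun t => t.1 = 0) := by
      rw [List.length_eq_countP_add_countP (fun t : ℤ × ℤ => decide (t.1 ≠ 0))]
      simp
    refine ⟨(terms L e₀).countP (fun t => t.1 ≠ 0), (terms L e₀).countP (fun t => t.1 = 0),
      ?_, (even_countP_terms L e₀).2 h0, fun k₀ k₁ hk => ?_, fun k => ?_, fun hN k => ?_,
      fun hN hZ => ?_⟩
    · rw [cycCount_of_isConj 1 hc, hg.cycCount_one h0, ← hlen, length_terms]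
    · rw [hA, hA]; exact sum_abs_add_sum_abs_ge ht hk
    · rw [hA, hA]; exact even_sum_abs (fun t h => (ht t h).1) k
    · rw [List.countP_eq_zero] at hN
      have := twist_eq_self (L := L) (e₀ := e₀) (fun t h => by simpa using hN t h) k
      refine (isConj_tw hc k).trans ((isConj_tw_syl k h0).trans ?_)
      rw [this]
      exact hc.symm
    · have hl : L.length = 2 := by rw [← length_terms L e₀, hlen, hN, hZ]
      obtain ⟨⟨e, x⟩, ⟨e', y⟩, rfl⟩ := List.length_eq_two.1 hl
      simp only [nextSign] at h0
      subst h0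
      have hee : e' = e := by
        rw [List.countP_eq_zero] at hZ
        have h3 : slope e (nextSign [(e', y)] e) ≠ 0 := by simpa using hZ _ List.mem_cons_self
        rw [nextSign_cons] at h3
        by_contra hne
        exact h3 (by simp [slope, Ne.symm hne])
      subst hee
      obtain ⟨d, hd, hd2⟩ : ∃ d : ℤ, slope e' e' = d ∧ (d = 1 ∨ d = -1) :=
        ⟨_, rfl, by cases e' <;> decide⟩
      have tt : ∀ k, twist k [(e', x), (e', y)] e' = [(e', x + k * d), (e', y + k * d)] := by
        intro k; simp [twist, nextSign, hd]
      refine ⟨-d * x, -d * y, fun k => ?_, fun k => ?_⟩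
      · rw [hA]
        simp only [terms, nextSign, hd, List.map_cons, List.map_nil, List.sum_cons, List.sum_nil,
          add_zero]
        rcases hd2 with rfl | rfl
        · congr 2 <;> ring
        · rw [← abs_neg, ← abs_neg (y + _)]
          congr 2 <;> ring
      · have c : ∀ k, IsConj (tw k w) (syl [(e', x + k * d), (e', y + k * d)]) := fun k => by
          have := (isConj_tw hc k).trans (isConj_tw_syl k rfl)
          rwa [tt] at this
        refine (RelJ.of_isConj (c k)).trans ((relJ_tw_pair _ _ _).trans (RelJ.of_isConj ?_))
        have := (c (-d * x + -d * y - k)).symm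
        rcases hd2 with rfl | rfl <;> (convert this using 4 <;> [ring_nf; (congr 2; ring_nf)])

theorem cycCount_one_tw (k : ℤ) (w : F₂) : cycCount 1 (tw k w) = cycCount 1 w := by
  rcases exists_isConj_syl w with ⟨m, hm⟩ | ⟨L, e₀, h0, hg, hc⟩
  · have : IsConj (tw k w) w := by
      refine (isConj_tw hm k).trans ?_
      rw [map_zpow, tw_a]
      exact hm.symm
    exact cycCount_of_isConj 1 this
  · rw [cycCount_of_isConj 1 (isConj_tw hc k), hg.cycCount_one_tw h0, cycCount_of_isConj 1 hc,
      hg.cycCount_one h0]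

/-- Convexity of the letter count along the powers of the twist. -/
theorem two_mul_cycCount_zero_le (w : F₂) :
    2 * cycCount 0 w ≤ cycCount 0 (tw (-1) w) + cycCount 0 (tw 1 w) := by
  rcases exists_isConj_syl w with ⟨m, hm⟩ | ⟨L, e₀, h0, hg, hc⟩
  · have ct : ∀ k : ℤ, IsConj (tw k w) w := fun k => by
      refine (isConj_tw hm k).trans ?_
      rw [map_zpow, tw_a]
      exact hm.symm
    rw [cycCount_of_isConj 0 (ct 1), cycCount_of_isConj 0 (ct (-1)), two_mul]
  · have hA : ∀ k, (cycCount 0 (tw k w) : ℤ) =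
        ((terms L e₀).map (fun t => |t.2 + k * t.1|)).sum := fun k => by
      rw [cycCount_of_isConj 0 (isConj_tw hc k), hg.cycCount_zero_tw h0]
    have := two_mul_sum_abs_le (terms L e₀) 0
    rw [← hA, zero_sub, zero_add, ← hA, ← hA, tw_zero] at this
    exact_mod_cast this

/-- The other convexity inequality, for the roles of `a` and `b` exchanged: both `tw (±1)` preserve
the number of letters `b^{±1}`. -/
theorem two_mul_cycCount_one_le (w : F₂) :
    2 * cycCount 1 w ≤ cycCount 0 (tw (-1) w) + cycCount 0 (tw 1 w) := by
  obtain ⟨N, Z, h1, -, h2, -⟩ := exists_fan w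
  have := h2 (-1) 1 (by norm_num)
  rw [h1]
  zify
  linarith

/-! ### Peak reduction -/

theorem cycCount_tw_flip (i : Fin 2) (k : ℤ) (w : F₂) :
    cycCount i (tw k (flip w)) = cycCount i (tw (-k) w) := by
  have := flip_tw (-k) w
  rw [neg_neg] at this
  rw [← cycCount_flip i (tw (-k) w), this, cycCount_conj]

theorem cycCount_zero_tw' (k : ℤ) (w : F₂) : cycCount 0 (tw' k w) = cycCount 0 w := by
  rw [← cycCount_one_swap, swap_tw', cycCount_one_tw, cycCount_one_swap]

theorem cycCount_zero_tw_neg_one_tw' (w : F₂) :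
    cycCount 0 (tw (-1) (tw' 1 w)) = cycCount 1 w := by
  rw [tw_neg_one_tw', cycCount_conj, cycCount_zero_swap, cycCount_flip, cycCount_one_tw]

theorem cycCount_one_tw'_one (w : F₂) : cycCount 1 (tw' 1 w) = cycCount 0 (tw 1 w) := by
  rw [← cycCount_one_tw (-1), tw_neg_one_tw', cycCount_conj, cycCount_one_swap, cycCount_flip]

theorem cycCount_one_tw'_neg_one (w : F₂) : cycCount 1 (tw' (-1) w) = cycCount 0 (tw (-1) w) := by
  rw [← cycCount_tw_flip, ← cycCount_one_tw'_one, ← cycCount_flip 1 (tw' (-1) w), flip_tw', neg_neg]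

theorem cycLen_tw (k : ℤ) (w : F₂) : cycLen (tw k w) = cycCount 0 (tw k w) + cycCount 1 w := by
  rw [cycLen, cycCount_one_tw]

theorem cycLen_tw'_one (w : F₂) : cycLen (tw' 1 w) = cycCount 0 w + cycCount 0 (tw 1 w) := by
  rw [cycLen, cycCount_one_tw'_one, cycCount_zero_tw']

theorem cycLen_tw'_neg_one (w : F₂) :
    cycLen (tw' (-1) w) = cycCount 0 w + cycCount 0 (tw (-1) w) := by
  rw [cycLen, cycCount_one_tw'_neg_one, cycCount_zero_tw']

theorem relJ_tw_flip (k : ℤ) (w : F₂) : RelJ (tw (-k) w) (tw k (flip w)) := by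
  have := flip_tw (-k) w
  rw [neg_neg] at this
  exact (relJ_flip _).trans (this ▸ (relJ_conj _ _).symm)

theorem relJ_tw'_flip (k : ℤ) (w : F₂) : RelJ (tw' (-k) w) (tw' k (flip w)) := by
  have := flip_tw' (-k) w
  rw [neg_neg] at this
  exact this ▸ relJ_flip _

theorem relJ_tw_neg_one_tw' (w : F₂) : RelJ (tw (-1) (tw' 1 w)) (tw 1 w) := by
  rw [tw_neg_one_tw']
  exact ((relJ_flip _).trans ((relJ_swap _).trans (relJ_conj _ _))).symm

theorem relJ_tw_swap (k : ℤ) (w : F₂) : RelJ (tw k w) (tw' k (swap w)) := by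
  rw [← swap_tw]; exact relJ_swap _

theorem relJ_tw'_swap (k : ℤ) (w : F₂) : RelJ (tw' k w) (tw k (swap w)) := by
  rw [← swap_tw']; exact relJ_swap _

theorem relJ_tw'_neg_one_tw (w : F₂) : RelJ (tw' (-1) (tw 1 w)) (tw' 1 w) := by
  have h := relJ_tw_neg_one_tw' (swap w)
  rw [← swap_tw] at h
  exact (relJ_tw'_swap (-1) _).trans (h.trans (relJ_tw'_swap 1 w).symm)

/-- A property which is invariant under `J` and under the twists by `±1` is invariant under all
automorphisms. -/
theorem aut_induction {P : F₂ → Prop} (hJ : ∀ u v, RelJ u v → P u → P v)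
    (h1 : ∀ u, P u → P (tw 1 u)) (h2 : ∀ u, P u → P (tw (-1) u)) {w : F₂} (hw : P w)
    (φ : MulAut F₂) : P (φ w) := by
  let S : Subgroup (MulAut F₂) :=
    { carrier := {φ | (∀ u, P u → P (φ u)) ∧ ∀ u, P u → P (φ⁻¹ u)}
      one_mem' := ⟨fun _ h => h, fun _ h => h⟩
      mul_mem' := by
        rintro x y ⟨hx, hx'⟩ ⟨hy, hy'⟩
        refine ⟨fun u hu => hx _ (hy _ hu), fun u hu => ?_⟩
        rw [mul_inv_rev]
        exact hy' _ (hx' _ hu)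
      inv_mem' := by
        rintro x ⟨hx, hx'⟩
        exact ⟨hx', by simpa using hx⟩ }
  have hle : genSubgroup ≤ S := by
    refine sup_le (fun φ hφ => ⟨fun u => hJ _ _ ⟨φ, hφ, rfl⟩, fun u =>
      hJ _ _ ⟨φ⁻¹, J.inv_mem hφ, rfl⟩⟩) ?_
    rw [Subgroup.zpowers_le]
    refine ⟨h1, fun u hu => ?_⟩
    have : (tw 1)⁻¹ = tw (-1) := by
      rw [inv_eq_iff_mul_eq_one, ← tw_add]; exact tw_zero
    rw [this]
    exact h2 u hu
  have : φ ∈ S := hle (genSubgroup_eq_top ▸ Subgroup.mem_top φ)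
  exact this.1 w hw

/-- The image of `v` under a product of the positive automorphisms `tw 1` and `tw' 1`. -/
def posPath : List Bool → F₂ → F₂
  | [], v => v
  | true :: m, v => tw 1 (posPath m v)
  | false :: m, v => tw' 1 (posPath m v)

/-- Every automorphic image of `w` is reached from the `J`-class of `w` by a positive
automorphism: this is a path without backtracking in the dual tree of the Farey graph. -/
theorem exists_posPath (w : F₂) (φ : MulAut F₂) :
    ∃ v m, RelJ w v ∧ RelJ (posPath m v) (φ w) := by
  have hneg : ∀ m v, RelJ w v →
      ∃ v' m', RelJ w v' ∧ RelJ (posPath m' v') (tw (-1) (posPath m v)) := by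
    intro m v hv
    match m with
    | [] => exact ⟨flip v, [true], hv.trans (relJ_flip v), (relJ_tw_flip 1 v).symm⟩
    | true :: m =>
      refine ⟨v, m, hv, ?_⟩
      rw [posPath, tw_tw, neg_add_cancel, tw_zero]
      exact RelJ.refl _
    | false :: m => exact ⟨v, true :: m, hv, (relJ_tw_neg_one_tw' _).symm⟩
  have hneg' : ∀ m v, RelJ w v →
      ∃ v' m', RelJ w v' ∧ RelJ (posPath m' v') (tw' (-1) (posPath m v)) := by
    intro m v hv
    match m with
    | [] => exact ⟨flip v, [false], hv.trans (relJ_flip v), (relJ_tw'_flip 1 v).symm⟩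
    | false :: m =>
      refine ⟨v, m, hv, ?_⟩
      rw [posPath, tw'_tw', neg_add_cancel, tw', tw_zero, mul_one, swap_mul_swap]
      exact RelJ.refl _
    | true :: m => exact ⟨v, false :: m, hv, (relJ_tw'_neg_one_tw _).symm⟩
  have step : ∀ k : ℤ, k = 1 ∨ k = -1 → ∀ u, (∃ v m, RelJ w v ∧ RelJ (posPath m v) u) →
      ∃ v m, RelJ w v ∧ RelJ (posPath m v) (tw k u) := by
    rintro k hk u ⟨v, m, hv, j, hj, rfl⟩
    rcases (relJ_moves hj (posPath m v) k hk).1 with h | h | h | h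
    · exact ⟨v, true :: m, hv, h.symm⟩
    · obtain ⟨v', m', h1, h2⟩ := hneg m v hv
      exact ⟨v', m', h1, h2.trans h.symm⟩
    · exact ⟨v, false :: m, hv, h.symm⟩
    · obtain ⟨v', m', h1, h2⟩ := hneg' m v hv
      exact ⟨v', m', h1, h2.trans h.symm⟩
  refine aut_induction (P := fun u => ∃ v m, RelJ w v ∧ RelJ (posPath m v) u) ?_
    (step 1 (Or.inl rfl)) (step (-1) (Or.inr rfl)) ⟨w, [], RelJ.refl w, RelJ.refl w⟩ φ
  rintro u u' h ⟨v, m, h1, h2⟩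
  exact ⟨v, m, h1, h2.trans h⟩

/-- The length does not decrease under the two positive twists. -/
def IsRising (v : F₂) : Prop :=
  cycCount 0 v ≤ cycCount 0 (tw 1 v) ∧ cycCount 1 v ≤ cycCount 0 (tw 1 v)

/-- Convexity of the length: once it rises along a positive path, it keeps rising. -/
theorem IsRising.tw_one {v : F₂} (h : IsRising v) : IsRising (tw 1 v) := by
  have h1 := two_mul_cycCount_zero_le (tw 1 v)
  rw [tw_tw, neg_add_cancel, tw_zero] at h1
  obtain ⟨h2, h3⟩ := h
  unfold IsRising
  rw [cycCount_one_tw 1 v]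
  change 2 * _ ≤ cycCount 0 v + _ at h1
  omega

theorem IsRising.tw'_one {v : F₂} (h : IsRising v) : IsRising (tw' 1 v) := by
  have h1 := two_mul_cycCount_one_le (tw' 1 v)
  rw [cycCount_zero_tw_neg_one_tw', cycCount_one_tw'_one] at h1
  obtain ⟨h2, h3⟩ := h
  unfold IsRising
  rw [cycCount_one_tw'_one, cycCount_zero_tw']
  omega

/-- No one-letter automorphism shortens the cyclic word. -/
def IsLocallyMinimal (w : F₂) : Prop := ∀ v, RelJ w v → cycLen w ≤ cycLen (tw 1 v)

theorem IsLocallyMinimal.isRising {w : F₂} (h : IsLocallyMinimal w) : IsRising w := by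
  have h1 := h w (RelJ.refl w)
  have h2 := h (swap w) (relJ_swap w)
  rw [(relJ_tw'_swap 1 w).symm.cycLen_eq, cycLen_tw'_one] at h2
  rw [cycLen_tw] at h1
  unfold cycLen at h1 h2
  constructor <;> omega

theorem IsLocallyMinimal.of_relJ {v w : F₂} (h : IsLocallyMinimal w) (hv : RelJ w v) :
    IsLocallyMinimal v := by
  intro u hu
  rw [← hv.cycLen_eq]
  exact h u (hv.trans hu)

/-- **Whitehead's theorem** in rank two: a locally minimal word has minimal length in its
orbit, and the words of minimal length are connected by `J` and by length-preserving twists. -/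
theorem IsLocallyMinimal.connected {w : F₂} (hw : IsLocallyMinimal w) {P : F₂ → Prop}
    (hJ : ∀ u v, RelJ u v → P u → P v) (h0 : P w)
    (hstep : ∀ u, P u → cycLen u = cycLen w → cycLen (tw 1 u) = cycLen w → P (tw 1 u))
    (φ : MulAut F₂) :
    cycLen w ≤ cycLen (φ w) ∧ (cycLen (φ w) = cycLen w → P (φ w)) := by
  obtain ⟨v, m, hv, hm⟩ := exists_posPath w φ
  have key : IsRising (posPath m v) ∧ cycLen w ≤ cycLen (posPath m v) ∧
      (cycLen (posPath m v) = cycLen w → P (posPath m v)) := by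
    induction m generalizing φ with
    | nil =>
      exact ⟨(hw.of_relJ hv).isRising, hv.cycLen_eq.le, fun _ => hJ _ _ hv h0⟩
    | cons t m ih =>
      obtain ⟨j, hj, e⟩ := hm
      obtain ⟨φ', hφ'⟩ : ∃ φ' : MulAut F₂, posPath m v = φ' w := by
        obtain ⟨j', -, e'⟩ := hv
        cases t
        · exact ⟨(tw' 1)⁻¹ * j⁻¹ * φ, by
            rw [MulAut.mul_apply, MulAut.mul_apply, ← e]; simp [posPath]⟩
        · exact ⟨(tw 1)⁻¹ * j⁻¹ * φ, by
            rw [MulAut.mul_apply, MulAut.mul_apply, ← e]; simp [posPath]⟩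
      obtain ⟨h1, h2, h3⟩ := ih φ' (hφ' ▸ RelJ.refl _)
      cases t
      · have h4 : cycLen (posPath m v) ≤ cycLen (posPath (false :: m) v) := by
          rw [posPath, cycLen_tw'_one, cycLen]
          have := h1.2
          omega
        refine ⟨h1.tw'_one, h2.trans h4, fun h5 => ?_⟩
        have h6 : cycLen (posPath m v) = cycLen w := by omega
        have h7 := relJ_tw'_swap 1 (posPath m v)
        refine hJ _ _ h7.symm (hstep _ (hJ _ _ (relJ_swap _) (h3 h6)) ?_ ?_)
        · rw [← (relJ_swap _).cycLen_eq, h6]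
        · rw [← h7.cycLen_eq]; exact h5
      · have h4 : cycLen (posPath m v) ≤ cycLen (posPath (true :: m) v) := by
          rw [posPath, cycLen_tw, cycLen]
          have := h1.1
          omega
        refine ⟨h1.tw_one, h2.trans h4, fun h5 => ?_⟩
        have h6 : cycLen (posPath m v) = cycLen w := by omega
        exact hstep _ (h3 h6) h6 h5
  rw [← hm.cycLen_eq]
  exact ⟨key.2.1, fun h => hJ _ _ hm (key.2.2 h)⟩

theorem IsLocallyMinimal.le {w : F₂} (hw : IsLocallyMinimal w) (φ : MulAut F₂) :
    cycLen w ≤ cycLen (φ w) :=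
  (hw.connected (P := fun _ => True) (by simp) trivial (by simp) φ).1

/-- All length-preserving moves from the `J`-class of `c` lead to `J`-classes of elements of
`C`. -/
def ClosedAt (C : Set F₂) (c : F₂) : Prop :=
  ∀ v, RelJ c v → cycLen (tw 1 v) = cycLen c → ∃ d ∈ C, RelJ d (tw 1 v)

theorem ClosedAt.of_relJ {C : Set F₂} {c c' : F₂} (h : ClosedAt C c) (hc : RelJ c' c) :
    ClosedAt C c' := fun v hv hl =>
  h v (hc.symm.trans hv) (by rw [hl, hc.cycLen_eq])

theorem closedAt_of_moves {C : Set F₂} {c : F₂}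
    (h1 : cycLen (tw 1 c) = cycLen c → ∃ d ∈ C, RelJ d (tw 1 c))
    (h2 : cycLen (tw (-1) c) = cycLen c → ∃ d ∈ C, RelJ d (tw (-1) c))
    (h3 : cycLen (tw' 1 c) = cycLen c → ∃ d ∈ C, RelJ d (tw' 1 c))
    (h4 : cycLen (tw' (-1) c) = cycLen c → ∃ d ∈ C, RelJ d (tw' (-1) c)) : ClosedAt C c := by
  rintro v ⟨j, hj, rfl⟩ hl
  rcases (relJ_moves hj c 1 (Or.inl rfl)).1 with h | h | h | h <;> rw [h.cycLen_eq] at hl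
  · obtain ⟨d, hd, hr⟩ := h1 hl
    exact ⟨d, hd, hr.trans h.symm⟩
  · obtain ⟨d, hd, hr⟩ := h2 hl
    exact ⟨d, hd, hr.trans h.symm⟩
  · obtain ⟨d, hd, hr⟩ := h3 hl
    exact ⟨d, hd, hr.trans h.symm⟩
  · obtain ⟨d, hd, hr⟩ := h4 hl
    exact ⟨d, hd, hr.trans h.symm⟩

/-- A set of words of minimal length which is closed under length-preserving moves contains a
representative of every word of minimal length. -/
theorem IsLocallyMinimal.exists_rep {w : F₂} (hw : IsLocallyMinimal w) {C : Set F₂} (h0 : w ∈ C)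
    (h : ∀ c ∈ C, cycLen c = cycLen w → ClosedAt C c)
    {φ : MulAut F₂} (hφ : cycLen (φ w) = cycLen w) : ∃ c ∈ C, RelJ c (φ w) := by
  refine (hw.connected (P := fun u => ∃ c ∈ C, RelJ c u) ?_ ⟨w, h0, RelJ.refl w⟩ ?_ φ).2 hφ
  · rintro u v huv ⟨c, hc, hcu⟩
    exact ⟨c, hc, hcu.trans huv⟩
  · rintro u ⟨c, hc, hr⟩ hu hl
    have hcw : cycLen c = cycLen w := hr.cycLen_eq.trans hu
    exact h c hc hcw u hr (hl.trans hcw.symm)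

theorem IsLocallyMinimal.map {w : F₂} (hw : IsLocallyMinimal w) {φ : MulAut F₂}
    (hφ : cycLen (φ w) = cycLen w) : IsLocallyMinimal (φ w) := by
  rintro v ⟨j, -, rfl⟩
  rw [hφ]
  exact hw.le (tw 1 * (j * φ))

/-! ### The number of classes of minimal words -/

theorem cycCount_zero_tw_swap_one (w : F₂) :
    cycCount 0 (tw 1 (swap w)) = cycCount 0 (tw 1 w) := by
  rw [← cycCount_one_swap, swap_tw, swap_swap, cycCount_one_tw'_one]

theorem cycCount_zero_tw_swap_neg_one (w : F₂) :
    cycCount 0 (tw (-1) (swap w)) = cycCount 0 (tw (-1) w) := by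
  rw [← cycCount_one_swap, swap_tw, swap_swap, cycCount_one_tw'_neg_one]

theorem IsLocallyMinimal.le_tw_one {w : F₂} (h : IsLocallyMinimal w) :
    max (cycCount 0 w) (cycCount 1 w) ≤ cycCount 0 (tw 1 w) :=
  max_le h.isRising.1 h.isRising.2

theorem IsLocallyMinimal.le_tw_neg_one {w : F₂} (h : IsLocallyMinimal w) :
    max (cycCount 0 w) (cycCount 1 w) ≤ cycCount 0 (tw (-1) w) := by
  have := (h.of_relJ (relJ_flip w)).le_tw_one
  rwa [cycCount_tw_flip, cycCount_flip, cycCount_flip] at this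

/-- The edge of the Farey graph given by `w` has length-preserving moves across both of the
triangles which contain it. -/
def IsTwoSided (w : F₂) : Prop :=
  cycCount 0 (tw 1 w) = max (cycCount 0 w) (cycCount 1 w) ∧
    cycCount 0 (tw (-1) w) = max (cycCount 0 w) (cycCount 1 w)

theorem IsTwoSided.flip {w : F₂} (h : IsTwoSided w) : IsTwoSided (flip w) := by
  unfold IsTwoSided
  rw [cycCount_tw_flip, cycCount_tw_flip, cycCount_flip, cycCount_flip, neg_neg]
  exact ⟨h.2, h.1⟩

theorem IsTwoSided.swap {w : F₂} (h : IsTwoSided w) : IsTwoSided (swap w) := by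
  unfold IsTwoSided
  rw [cycCount_zero_tw_swap_one, cycCount_zero_tw_swap_neg_one, cycCount_zero_swap,
    cycCount_one_swap, max_comm]
  exact h

theorem tw_neg_one_tw_one (w : F₂) : tw (-1) (tw 1 w) = w := by
  rw [tw_tw, neg_add_cancel, tw_zero]; rfl

theorem tw'_neg_one_tw'_one (w : F₂) : tw' (-1) (tw' 1 w) = w := by
  rw [tw'_tw', neg_add_cancel, tw', tw_zero, mul_one, swap_mul_swap]; rfl

/-- If no minimal word is two-sided, then the minimal words belong to one triangle. -/
theorem exists_reps_of_not_isTwoSided {w : F₂} (hw : IsLocallyMinimal w)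
    (hn : ∀ φ : MulAut F₂, cycLen (φ w) = cycLen w → ¬ IsTwoSided (φ w))
    (hz : max (cycCount 0 w) (cycCount 1 w) < cycCount 0 (tw (-1) w)) :
    ∃ C : Finset F₂, C.card ≤ 3 ∧
      ∀ φ : MulAut F₂, cycLen (φ w) = cycLen w → ∃ c ∈ C, RelJ c (φ w) := by
  refine ⟨{w, tw 1 w, tw' 1 w}, Finset.card_le_three, fun φ hφ => ?_⟩
  suffices h : ∃ c ∈ ({w, tw 1 w, tw' 1 w} : Set F₂), RelJ c (φ w) by simpa using h
  have hup := hw.le_tw_one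
  refine hw.exists_rep (by simp) ?_ hφ
  intro c hc hl
  rcases hc with rfl | rfl | rfl
  · refine closedAt_of_moves (fun _ => ⟨_, by simp, RelJ.refl _⟩) (fun h => ?_)
      (fun _ => ⟨_, by simp, RelJ.refl _⟩) (fun h => ?_)
    · rw [cycLen_tw, cycLen] at h; omega
    · rw [cycLen_tw'_neg_one, cycLen] at h; omega
  · have h1 := (hw.map (φ := tw 1) hl).le_tw_one
    have h2 := hn (tw 1) hl
    unfold IsTwoSided at h2
    rw [tw_neg_one_tw_one] at h2
    rw [cycCount_one_tw] at h1 h2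
    have e : cycCount 0 (tw 1 w) = cycCount 0 w := by
      rw [cycLen_tw, cycLen] at hl; omega
    refine closedAt_of_moves (fun h => ?_) (fun _ => ⟨w, by simp, ?_⟩) (fun h => ?_)
      (fun _ => ⟨tw' 1 w, by simp, (relJ_tw'_neg_one_tw w).symm⟩)
    · rw [cycLen_tw 1 (tw 1 w), cycLen, cycCount_one_tw] at h; omega
    · rw [tw_neg_one_tw_one]; exact RelJ.refl w
    · rw [cycLen_tw'_one, cycLen, cycCount_one_tw] at h; omega
  · have h1 := (hw.map (φ := tw' 1) hl).le_tw_one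
    have h2 := hn (tw' 1) hl
    unfold IsTwoSided at h2
    rw [cycCount_zero_tw_neg_one_tw'] at h2
    rw [cycCount_zero_tw', cycCount_one_tw'_one] at h1 h2
    have e : cycCount 0 (tw 1 w) = cycCount 1 w := by
      rw [cycLen_tw'_one, cycLen] at hl; omega
    refine closedAt_of_moves (fun h => ?_)
      (fun _ => ⟨tw 1 w, by simp, (relJ_tw_neg_one_tw' w).symm⟩) (fun h => ?_)
      (fun _ => ⟨w, by simp, ?_⟩)
    · rw [cycLen_tw 1 (tw' 1 w), cycLen, cycCount_zero_tw'] at h; omega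
    · rw [cycLen_tw'_one, cycLen, cycCount_zero_tw', cycCount_one_tw'_one] at h; omega
    · rw [tw'_neg_one_tw'_one]; exact RelJ.refl w

/-- If `w` and its four neighbours have the same length, then every length-preserving move from the
neighbour `tw 1 w` stays, up to `J`, in the triangle of `w`, `tw 1 w` and `tw' 1 w`. -/
theorem closedAt_tw_one {w : F₂} (h : IsTwoSided w) (he : cycCount 0 w = cycCount 1 w) :
    ClosedAt {w, tw 1 w, tw' 1 w} (tw 1 w) := by
  obtain ⟨N, Z, hNZ, -, hf, -, h0, -⟩ := exists_fan w
  have hf := hf (-1) 2 (by norm_num)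
  obtain ⟨hz', hz⟩ := h
  rw [← he, max_self] at hz hz'
  have hN : cycCount 0 (tw 2 w) = cycCount 0 w → N = 0 := by
    intro h2
    rw [h2, hz] at hf
    omega
  have e2 : tw 1 (tw 1 w) = tw 2 w := tw_tw 1 1 w
  refine closedAt_of_moves (fun hl => ?_) (fun _ => ⟨w, by simp, ?_⟩) (fun hl => ?_)
    (fun _ => ⟨tw' 1 w, by simp, (relJ_tw'_neg_one_tw w).symm⟩)
  · rw [e2] at hl ⊢
    rw [cycLen_tw, cycLen_tw] at hl
    exact ⟨w, by simp, (RelJ.of_isConj (h0 (hN (by omega)) 2)).symm⟩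
  · rw [tw_neg_one_tw_one]; exact RelJ.refl w
  · rw [cycLen_tw'_one, cycLen_tw, e2] at hl
    refine ⟨tw' 1 w, by simp, RelJ.of_isConj ?_⟩
    obtain ⟨g, hg⟩ := isConj_iff.1 (h0 (hN (by omega)) 1).symm
    exact isConj_iff.2 ⟨tw' 1 g, by rw [← map_inv, ← map_mul, ← map_mul, hg]⟩

/-- If the four neighbours of `w` have the length of `w`, then there are no further classes. -/
theorem exists_reps_of_eq {w : F₂} (hw : IsLocallyMinimal w) (h : IsTwoSided w)
    (he : cycCount 0 w = cycCount 1 w) :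
    ∃ C : Finset F₂, C.card ≤ 5 ∧
      ∀ φ : MulAut F₂, cycLen (φ w) = cycLen w → ∃ c ∈ C, RelJ c (φ w) := by
  refine ⟨{w, tw 1 w, tw' 1 w, tw (-1) w, tw' (-1) w}, Finset.card_le_five, fun φ hφ => ?_⟩
  set C : Set F₂ := {w, tw 1 w, tw' 1 w, tw (-1) w, tw' (-1) w} with hC
  suffices h : ∃ c ∈ C, RelJ c (φ w) by simpa [hC] using h
  have key : ∀ {v c : F₂}, IsTwoSided v → cycCount 0 v = cycCount 1 v → RelJ c (tw 1 v) →
      (∃ d ∈ C, RelJ d v) → (∃ d ∈ C, RelJ d (tw 1 v)) → (∃ d ∈ C, RelJ d (tw' 1 v)) →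
      ClosedAt C c := by
    intro v c hv hv' hc h1 h2 h3
    refine ClosedAt.of_relJ (fun u hu hl => ?_) hc
    obtain ⟨d, hd, hr⟩ := closedAt_tw_one hv hv' u hu hl
    rcases hd with rfl | rfl | rfl
    · obtain ⟨d', hd', hr'⟩ := h1; exact ⟨d', hd', hr'.trans hr⟩
    · obtain ⟨d', hd', hr'⟩ := h2; exact ⟨d', hd', hr'.trans hr⟩
    · obtain ⟨d', hd', hr'⟩ := h3; exact ⟨d', hd', hr'.trans hr⟩
  refine hw.exists_rep (by simp [hC]) ?_ hφ
  intro c hc _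
  rcases hc with rfl | rfl | rfl | rfl | rfl
  · exact closedAt_of_moves (fun _ => ⟨_, by simp [hC], RelJ.refl _⟩)
      (fun _ => ⟨tw (-1) c, by simp [hC], RelJ.refl _⟩)
      (fun _ => ⟨tw' 1 c, by simp [hC], RelJ.refl _⟩)
      (fun _ => ⟨tw' (-1) c, by simp [hC], RelJ.refl _⟩)
  · exact key h he (RelJ.refl _) ⟨w, by simp [hC], RelJ.refl _⟩
      ⟨tw 1 w, by simp [hC], RelJ.refl _⟩ ⟨tw' 1 w, by simp [hC], RelJ.refl _⟩
  · refine key h.swap ?_ (relJ_tw'_swap 1 w) ⟨w, by simp [hC], relJ_swap w⟩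
      ⟨tw' 1 w, by simp [hC], relJ_tw'_swap 1 w⟩ ⟨tw 1 w, by simp [hC], relJ_tw_swap 1 w⟩
    rw [cycCount_zero_swap, cycCount_one_swap, he]
  · refine key h.flip ?_ (relJ_tw_flip 1 w) ⟨w, by simp [hC], relJ_flip w⟩
      ⟨tw (-1) w, by simp [hC], relJ_tw_flip 1 w⟩ ⟨tw' (-1) w, by simp [hC], relJ_tw'_flip 1 w⟩
    rw [cycCount_flip, cycCount_flip, he]
  · refine key h.flip.swap ?_ ((relJ_tw'_flip 1 w).trans (relJ_tw'_swap 1 _))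
      ⟨w, by simp [hC], (relJ_flip w).trans (relJ_swap _)⟩
      ⟨tw' (-1) w, by simp [hC], (relJ_tw'_flip 1 w).trans (relJ_tw'_swap 1 _)⟩
      ⟨tw (-1) w, by simp [hC], (relJ_tw_flip 1 w).trans (relJ_tw_swap 1 _)⟩
    rw [cycCount_zero_swap, cycCount_one_swap, cycCount_flip, cycCount_flip, he]

/-- If the locally minimal word `w` has more letters `a^{±1}` than letters `b^{±1}`, then the words
of minimal length are obtained, up to `J`, by those powers of the twist `b ↦ b a` which preserve
the number of letters `a^{±1}`. -/
theorem exists_tw_of_lt {w : F₂} (hw : IsLocallyMinimal w)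
    (hlt : cycCount 1 w < cycCount 0 w) {φ : MulAut F₂} (hφ : cycLen (φ w) = cycLen w) :
    ∃ k : ℤ, cycCount 0 (tw k w) = cycCount 0 w ∧ RelJ (tw k w) (φ w) := by
  have := hw.exists_rep (C := {c | ∃ k : ℤ, cycCount 0 (tw k w) = cycCount 0 w ∧ c = tw k w})
    ⟨0, by rw [tw_zero]; exact ⟨rfl, rfl⟩⟩ ?_ hφ
  · obtain ⟨_, ⟨k, hk, rfl⟩, hr⟩ := this
    exact ⟨k, hk, hr⟩
  · rintro _ ⟨k, hk, rfl⟩ hl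
    have h1 := (hw.map hl).le_tw_one
    have h2 := (hw.map hl).le_tw_neg_one
    have hs : ∀ j : ℤ, cycLen (tw j (tw k w)) = cycLen (tw k w) →
        ∃ d ∈ {c | ∃ k : ℤ, cycCount 0 (tw k w) = cycCount 0 w ∧ c = tw k w},
          RelJ d (tw j (tw k w)) := by
      intro j hj
      rw [tw_tw] at hj ⊢
      refine ⟨_, ⟨j + k, ?_, rfl⟩, RelJ.refl _⟩
      rw [cycLen_tw, cycLen_tw] at hj
      omega
    refine closedAt_of_moves (hs 1) (hs (-1)) (fun h => ?_) (fun h => ?_)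
    · rw [cycLen_tw'_one, cycLen, cycCount_one_tw] at h
      omega
    · rw [cycLen_tw'_neg_one, cycLen, cycCount_one_tw] at h
      omega

/-- The main case: the minimal words are the words `tw k w` for `k` in the interval `[k₀, k₁]` on
which the convex function `k ↦ cycCount 0 (tw k w)` takes its minimum `A`. With `N` and `Z` as in
`exists_fan`, `N (k₁ - k₀) + 2 Z ≤ 2 A`, where `N` and `Z` are even and `A + N + Z` is the length.
This bounds the number of values of `k` by `n - 5`, unless `N = 0`, when there is only one class, or
`N = 2` and `Z = 0`. -/
theorem exists_reps_of_lt {w : F₂} (hw : IsLocallyMinimal w) (h : IsTwoSided w)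
    (hlt : cycCount 1 w < cycCount 0 w) (hn : 9 ≤ cycLen w) :
    ∃ C : Finset F₂, C.card ≤ cycLen w - 5 ∧
      ∀ φ : MulAut F₂, cycLen (φ w) = cycLen w → ∃ c ∈ C, RelJ c (φ w) := by
  obtain ⟨N, Z, hNZ, hZ, hf, hpar, h0, hsym⟩ := exists_fan w
  obtain ⟨hz', hz⟩ := h
  rw [max_eq_left hlt.le] at hz hz'
  set A := cycCount 0 w with hA
  have hlen : cycLen w = A + (N + Z) := by rw [cycLen, hNZ]
  have hN2 : Even N := by
    have := hpar 0
    rw [zero_add, hz', tw_zero] at this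
    change Even ((A : ℤ) + A + N) at this
    rw [Int.even_add] at this
    exact_mod_cast this.1 ⟨_, rfl⟩
  rcases Nat.eq_zero_or_pos N with hN0 | hN0
  · refine ⟨{w}, by rw [Finset.card_singleton]; omega, fun φ hφ => ⟨w, by simp, ?_⟩⟩
    obtain ⟨k, -, hr⟩ := exists_tw_of_lt hw hlt hφ
    exact (RelJ.of_isConj (h0 hN0 k)).symm.trans hr
  have hN : 2 ≤ N := by
    obtain ⟨r, hr⟩ := hN2; omega
  by_cases hcase : N = 2 ∧ Z = 0
  · -- The reflection of the flat interval identifies its two halves.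
    obtain ⟨hN', hZ'⟩ := hcase
    obtain ⟨p, q, hpq, hle, hs⟩ : ∃ p q : ℤ, (∀ k, (cycCount 0 (tw k w) : ℤ) = |k - p| + |k - q|) ∧
        p ≤ q ∧ ∀ k, RelJ (tw k w) (tw (p + q - k) w) := by
      obtain ⟨p, q, h1, h2⟩ := hsym hN' hZ'
      rcases le_total p q with h | h
      · exact ⟨p, q, h1, h, h2⟩
      · exact ⟨q, p, fun k => by rw [h1, add_comm], h, fun k => by rw [add_comm q]; exact h2 k⟩
    have e0 := hpq 0
    have e1 := hpq 1
    have e2 := hpq (-1)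
    rw [hz'] at e1
    rw [hz] at e2
    rw [tw_zero] at e0
    change (A : ℤ) = _ at e0
    have hApq : (A : ℤ) = q - p := by
      rcases abs_cases (0 - p) with h | h <;> rcases abs_cases (0 - q) with h' | h' <;>
      rcases abs_cases (1 - p) with g | g <;> rcases abs_cases (1 - q) with g' | g' <;>
      rcases abs_cases (-1 - p) with i | i <;> rcases abs_cases (-1 - q) with i' | i' <;> omega
    refine ⟨(Finset.Icc p (p + (A / 2 : ℕ))).image (fun k => tw k w), ?_, fun φ hφ => ?_⟩
    · refine Finset.card_image_le.trans ?_
      rw [Int.card_Icc]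
      omega
    · obtain ⟨k, hk, hr⟩ := exists_tw_of_lt hw hlt hφ
      have hk' := hpq k
      rw [hk] at hk'
      have hk2 : p ≤ k ∧ k ≤ q := by
        rcases abs_cases (k - p) with h | h <;> rcases abs_cases (k - q) with h' | h' <;> omega
      by_cases hkk : k ≤ p + (A / 2 : ℕ)
      · exact ⟨_, Finset.mem_image.2 ⟨k, Finset.mem_Icc.2 ⟨hk2.1, hkk⟩, rfl⟩, hr⟩
      · refine ⟨_, Finset.mem_image.2 ⟨p + q - k, Finset.mem_Icc.2 ⟨by omega, by omega⟩, rfl⟩,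
          (hs k).symm.trans hr⟩
  · set K := (Finset.Icc (-(2 * A : ℤ)) (2 * A)).filter (fun k => cycCount 0 (tw k w) = A) with hK
    have hfK : ∀ k₀ k₁ : ℤ, k₀ ≤ k₁ → cycCount 0 (tw k₀ w) = A → cycCount 0 (tw k₁ w) = A →
        N * (k₁ - k₀) + 2 * Z ≤ 2 * A := by
      intro k₀ k₁ hk h1 h2
      have := hf k₀ k₁ hk
      rw [h1, h2] at this
      linarith
    have hmem : ∀ k : ℤ, cycCount 0 (tw k w) = A → k ∈ K := by
      intro k hk
      have c0 : cycCount 0 (tw 0 w) = A := by rw [tw_zero]; rfl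
      rw [hK, Finset.mem_filter, Finset.mem_Icc]
      refine ⟨?_, hk⟩
      have hNc : (2 : ℤ) ≤ N := by exact_mod_cast hN
      have hZc : (0 : ℤ) ≤ Z := by positivity
      rcases le_total 0 k with h | h
      · have := hfK 0 k h c0 hk
        constructor <;> nlinarith
      · have := hfK k 0 h hk c0
        constructor <;> nlinarith
    have m1 : (1 : ℤ) ∈ K := hmem 1 hz'
    have m2 : (-1 : ℤ) ∈ K := hmem (-1) hz
    have hne : K.Nonempty := ⟨1, m1⟩
    set k₀ := K.min' hne
    set k₁ := K.max' hne
    have hk₀ : k₀ ≤ -1 := K.min'_le _ m2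
    have hk₁ : 1 ≤ k₁ := K.le_max' _ m1
    have hD := hfK k₀ k₁ (by omega) (Finset.mem_filter.1 (K.min'_mem hne)).2
      (Finset.mem_filter.1 (K.max'_mem hne)).2
    refine ⟨K.image (fun k => tw k w), ?_, fun φ hφ => ?_⟩
    · refine Finset.card_image_le.trans ?_
      have hsub : K ⊆ Finset.Icc k₀ k₁ := fun k hk =>
        Finset.mem_Icc.2 ⟨K.min'_le _ hk, K.le_max' _ hk⟩
      refine (Finset.card_le_card hsub).trans ?_
      rw [Int.card_Icc, hlen]
      obtain ⟨r, hr⟩ := hN2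
      obtain ⟨s, hs⟩ := hZ
      have hdd : 2 ≤ k₁ - k₀ := by omega
      by_cases hN4 : N = 2
      · rw [hN4] at hD
        push_cast at hD
        omega
      · have : (4 : ℤ) * (k₁ - k₀) ≤ N * (k₁ - k₀) :=
          mul_le_mul_of_nonneg_right (by omega) (by omega)
        omega
    · obtain ⟨k, hk, hr⟩ := exists_tw_of_lt hw hlt hφ
      exact ⟨_, Finset.mem_image.2 ⟨k, hmem k hk, rfl⟩, hr⟩

/-- There are at most `n - 5` classes of minimal words of length `n ≥ 9`. -/
theorem exists_reps {w : F₂} (hw : IsLocallyMinimal w) (hn : 9 ≤ cycLen w) :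
    ∃ C : Finset F₂, C.card ≤ cycLen w - 5 ∧
      ∀ φ : MulAut F₂, cycLen (φ w) = cycLen w → ∃ c ∈ C, RelJ c (φ w) := by
  have transfer : ∀ ψ : MulAut F₂, cycLen (ψ w) = cycLen w →
      (∃ C : Finset F₂, C.card ≤ cycLen (ψ w) - 5 ∧
        ∀ φ : MulAut F₂, cycLen (φ (ψ w)) = cycLen (ψ w) → ∃ c ∈ C, RelJ c (φ (ψ w))) →
      ∃ C : Finset F₂, C.card ≤ cycLen w - 5 ∧
        ∀ φ : MulAut F₂, cycLen (φ w) = cycLen w → ∃ c ∈ C, RelJ c (φ w) := by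
    rintro ψ hψ ⟨C, hC, h⟩
    refine ⟨C, hψ ▸ hC, fun φ hφ => ?_⟩
    have := h (φ * ψ⁻¹)
    simp only [MulAut.mul_apply, MulAut.inv_apply_self] at this
    exact this (by rw [hφ, hψ])
  by_cases hts : ∃ φ : MulAut F₂, cycLen (φ w) = cycLen w ∧ IsTwoSided (φ w)
  · obtain ⟨φ, hφ, h⟩ := hts
    have hsw : cycLen ((swap * φ) w) = cycLen w := by
      rw [MulAut.mul_apply, ← (relJ_swap _).cycLen_eq, hφ]
    rcases lt_trichotomy (cycCount 0 (φ w)) (cycCount 1 (φ w)) with hlt | heq | hlt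
    · refine transfer (swap * φ) hsw (exists_reps_of_lt (hw.map hsw) h.swap ?_ (hsw ▸ hn))
      rw [MulAut.mul_apply, cycCount_zero_swap, cycCount_one_swap]
      exact hlt
    · refine transfer φ hφ ?_
      obtain ⟨C, hC, h'⟩ := exists_reps_of_eq (hw.map hφ) h heq
      refine ⟨C, hC.trans ?_, h'⟩
      -- The length is even, hence at least ten.
      rw [← hφ] at hn
      unfold cycLen at hn ⊢
      omega
    · exact transfer φ hφ (exists_reps_of_lt (hw.map hφ) h hlt (hφ ▸ hn))
  · push Not at hts
    have h3 : ∀ C : Finset F₂, C.card ≤ 3 → C.card ≤ cycLen w - 5 := fun C hC => by omega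
    by_cases hz : max (cycCount 0 w) (cycCount 1 w) < cycCount 0 (tw (-1) w)
    · obtain ⟨C, hC, h⟩ := exists_reps_of_not_isTwoSided hw hts hz
      exact ⟨C, h3 C hC, h⟩
    · have hfl : cycLen (flip w) = cycLen w := (relJ_flip w).cycLen_eq.symm
      refine transfer flip hfl ?_
      have hlt : max (cycCount 0 (flip w)) (cycCount 1 (flip w)) <
          cycCount 0 (tw (-1) (flip w)) := by
        rw [cycCount_tw_flip, cycCount_flip, cycCount_flip, neg_neg]
        have h1 := hw.le_tw_one
        have h2 := hw.le_tw_neg_one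
        have h4 := hts 1 rfl
        unfold IsTwoSided at h4
        rw [MulAut.one_apply] at h4
        omega
      obtain ⟨C, hC, h⟩ := exists_reps_of_not_isTwoSided (hw.map hfl)
        (fun φ hφ => hts (φ * flip) (by rw [MulAut.mul_apply, hφ, hfl])) hlt
      exact ⟨C, hfl.symm ▸ h3 C hC, h⟩

/-! ### Cyclically reduced words in a conjugacy class -/

theorem isConj_mk_rotate (L : List (Fin 2 × Bool)) (r : ℕ) :
    IsConj (mk L : F₂) (mk (L.rotate r)) := by
  rw [List.rotate_eq_drop_append_take_mod]
  conv_lhs => rw [← List.take_append_drop (r % L.length) L]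
  rw [← mul_mk, ← mul_mk]
  exact isConj_iff.2 ⟨(mk (L.take (r % L.length)))⁻¹, by group⟩

theorem isCyclicallyReduced_rotate {L : List (Fin 2 × Bool)} (h : IsCyclicallyReduced L) (r : ℕ) :
    IsCyclicallyReduced (L.rotate r) := by
  have h1 := cycLen_mk h
  rw [cycLen_of_isConj (isConj_mk_rotate L r)] at h1
  have h2 : (mk (L.rotate r) : F₂).norm ≤ (L.rotate r).length := norm_mk_le
  have h3 := cycLen_le_norm (mk (L.rotate r))
  rw [List.length_rotate] at h2
  have h4 : (mk (L.rotate r) : F₂).norm = cycLen (mk (L.rotate r)) := by omega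
  have h5 : (mk (L.rotate r) : F₂).toWord = L.rotate r := by
    rw [toWord_mk]
    refine (reduce.red.sublist).eq_of_length ?_
    rw [← toWord_mk, List.length_rotate]
    change (mk (L.rotate r) : F₂).norm = _
    omega
  rw [← h5]
  exact isCyclicallyReduced_of_norm_eq h4

/-- The cyclically reduced conjugates of a cyclically reduced word are its rotations. The proof is
by induction on the length `n` of the conjugator `g`: if no cancellation occurs on either side of
the word in `g L g⁻¹`, the conjugate is too long. -/
theorem exists_rotate_of_norm_conj (n : ℕ) : ∀ {L : List (Fin 2 × Bool)} (g : F₂), L ≠ [] →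
    IsCyclicallyReduced L → g.norm = n → (g * mk L * g⁻¹).norm = L.length →
    ∃ r, g * mk L * g⁻¹ = mk (L.rotate r) := by
  induction n with
  | zero =>
    intro L g _ _ hg _
    rw [FreeGroup.norm_eq_zero] at hg
    exact ⟨0, by simp [hg]⟩
  | succ n ih =>
    intro L g hne hL hg hn
    have hgne : g.toWord ≠ [] := by
      intro h
      rw [FreeGroup.norm, h] at hg
      simp at hg
    obtain ⟨G, x, hGx⟩ : ∃ G x, g.toWord = G ++ [x] :=
      ⟨_, _, (List.dropLast_append_getLast hgne).symm⟩
    have hgr : FreeGroup.IsReduced (G ++ [x]) := hGx ▸ isReduced_toWord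
    have hG : FreeGroup.IsReduced G := hgr.infix ⟨[], [x], by simp⟩
    have hg' : g = mk G * letter x := by rw [letter, mul_mk, ← hGx, mk_toWord]
    have hGn : (mk G : F₂).norm = n := by
      rw [norm_mk_of_isReduced hG]
      have := congrArg List.length hGx
      rw [List.length_append] at this
      change g.norm = _ at this
      simp at this
      omega
    have finish : ∀ r₀, letter x * mk L * (letter x)⁻¹ = mk (L.rotate r₀) →
        ∃ r, g * mk L * g⁻¹ = mk (L.rotate r) := by
      intro r₀ e
      have e' : g * mk L * g⁻¹ = mk G * mk (L.rotate r₀) * (mk G)⁻¹ := by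
        rw [hg', ← e]; group
      obtain ⟨r, hr⟩ := ih (mk G) (by simpa using hne) (isCyclicallyReduced_rotate hL r₀) hGn
        (by rw [← e', hn, List.length_rotate])
      exact ⟨r₀ + r, by rw [e', hr, List.rotate_rotate]⟩
    have hcancel : ∀ y z : Fin 2 × Bool, ¬ (y.1 = z.1 → y.2 = z.2) → letter z = (letter y)⁻¹ := by
      rintro ⟨i, t⟩ ⟨j, u⟩ h
      push Not at h
      obtain ⟨rfl, h⟩ := h
      rw [letter_inv]
      cases t <;> cases u <;> simp_all
    obtain ⟨h, T, rfl⟩ : ∃ h T, L = h :: T := by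
      cases L with
      | nil => exact absurd rfl hne
      | cons h T => exact ⟨h, T, rfl⟩
    by_cases c1 : x.1 = h.1 → x.2 = h.2
    swap
    · refine finish 1 ?_
      have := hcancel x h c1
      rw [List.rotate_cons_succ, List.rotate_zero, ← mul_mk]
      change _ = mk T * letter h
      have e : (mk (h :: T) : F₂) = letter h * mk T := by simp [letter, mul_mk]
      rw [e, this]
      group
    obtain ⟨D, l, hD⟩ : ∃ D l, h :: T = D ++ [l] :=
      ⟨_, _, (List.dropLast_append_getLast (List.cons_ne_nil h T)).symm⟩
    by_cases c2 : l.1 = x.1 → l.2 = (!x.2)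
    swap
    · refine finish D.length ?_
      have hlx : l = x := by
        push Not at c2
        refine Prod.ext c2.1 ?_
        have := c2.2
        cases h1 : l.2 <;> cases h2 : x.2 <;> simp_all
      rw [hD, List.rotate_append_length_eq, ← mul_mk, ← mul_mk, hlx]
      change letter x * (mk D * letter x) * (letter x)⁻¹ = letter x * mk D
      group
    exfalso
    have hr : FreeGroup.IsReduced ((G ++ [x]) ++ ((h :: T) ++ invRev (G ++ [x]))) := by
      have hi := isReduced_invRev hgr
      have hLr := hL.isReduced
      unfold FreeGroup.IsReduced at *
      refine List.isChain_append.2 ⟨hgr, List.isChain_append.2 ⟨hLr, hi, ?_⟩, ?_⟩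
      · intro y hy z hz
        rw [hD] at hy
        simp [invRev] at hy hz
        subst hy hz
        exact c2
      · intro y hy z hz
        simp at hy hz
        subst hy hz
        exact c1
    have e : g * mk (h :: T) * g⁻¹ = mk ((G ++ [x]) ++ ((h :: T) ++ invRev (G ++ [x]))) := by
      rw [← hGx, ← mul_mk, ← mul_mk (L₁ := h :: T), ← inv_mk, mk_toWord, mul_assoc]
    rw [e, norm_mk_of_isReduced hr] at hn
    simp at hn
    omega

/-- A conjugacy class contains at most `n` cyclically reduced words, where `n` is their length. -/
theorem finite_conj_and_ncard_le {u : F₂} (hu : u ≠ 1) :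
    {v | IsConj u v ∧ v.norm = cycLen u}.Finite ∧
      {v | IsConj u v ∧ v.norm = cycLen u}.ncard ≤ cycLen u := by
  obtain ⟨v₀, h0, hn0⟩ := exists_isConj_norm_eq u
  have hlen : v₀.toWord.length = cycLen u := hn0
  have hsub : {v | IsConj u v ∧ v.norm = cycLen u} ⊆
      ((Finset.range (cycLen u)).image (fun r => (mk (v₀.toWord.rotate r) : F₂)) : Finset F₂) := by
    rintro v ⟨hv, hn⟩
    have hc : IsConj v₀ v := h0.symm.trans hv
    obtain ⟨g, rfl⟩ := isConj_iff.1 hc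
    have hne : v₀.toWord ≠ [] := by
      rw [Ne, toWord_eq_nil_iff]
      rintro rfl
      exact hu (isConj_one_left.1 h0)
    obtain ⟨r, hr⟩ := exists_rotate_of_norm_conj g.norm (L := v₀.toWord) g hne
      (isCyclicallyReduced_of_norm_eq (hn0.trans (cycLen_of_isConj h0))) rfl
      (by rw [mk_toWord, hn, hlen])
    rw [mk_toWord] at hr
    rw [hr, Finset.coe_image]
    refine ⟨r % v₀.toWord.length, ?_, ?_⟩
    · rw [Finset.coe_range, Set.mem_Iio, ← hlen]
      exact Nat.mod_lt _ (List.length_pos_iff.2 hne)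
    · simp only [List.rotate_mod]
  refine ⟨(Finset.finite_toSet _).subset hsub, ?_⟩
  refine (Set.ncard_le_ncard hsub (Finset.finite_toSet _)).trans ?_
  rw [Set.ncard_coe_finset]
  exact Finset.card_image_le.trans (by simp)

/-! ### Counting minimal words -/

/-- Every element of `J` is the product of an inner automorphism and one of the eight
permutations. -/
theorem exists_conj_mul_permutation {φ : MulAut F₂} (hφ : φ ∈ J) :
    ∃ (g : F₂) (i j k : Fin 2), φ = MulAut.conj g *
      (swap ^ (i : ℕ) * flip ^ (j : ℕ) * (swap * flip * swap) ^ (k : ℕ)) := by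
  have mulp : ∀ {π ρ : MulAut F₂}, IsPermutation π → IsPermutation ρ → IsPermutation (π * ρ) := by
    intro π ρ h1 h2
    unfold IsPermutation at *
    rw [MulAut.coe_mul, Set.image_comp, h2, h1]
  have sw : IsPermutation swap := by
    simp [IsPermutation, letters, Set.image_insert_eq]
    ext; simp; tauto
  have fl : IsPermutation flip := by
    simp [IsPermutation, letters, Set.image_insert_eq]
    ext; simp; tauto
  have conj_mul : ∀ (ψ : MulAut F₂) (g : F₂), ψ * MulAut.conj g = MulAut.conj (ψ g) * ψ := by
    intro ψ g
    ext x
    simp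
  have key : ∃ g π, IsPermutation π ∧ φ = MulAut.conj g * π := by
    refine J_induction (P := fun φ => ∃ g π, IsPermutation π ∧ φ = MulAut.conj g * π) ?_ ?_ ?_ ?_ hφ
    · exact ⟨1, 1, by simp [IsPermutation], by simp⟩
    · rintro h _ ⟨g, π, hπ, rfl⟩
      exact ⟨h * g, π, hπ, by rw [map_mul, mul_assoc]⟩
    · rintro _ ⟨g, π, hπ, rfl⟩
      exact ⟨swap g, swap * π, mulp sw hπ, by rw [← mul_assoc, conj_mul, mul_assoc]⟩
    · rintro _ ⟨g, π, hπ, rfl⟩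
      exact ⟨flip g, flip * π, mulp fl hπ, by rw [← mul_assoc, conj_mul, mul_assoc]⟩
  obtain ⟨g, π, hπ, rfl⟩ := key
  obtain ⟨i, j, k, rfl, hi, hj, hk⟩ := isPermutation_cases hπ
  exact ⟨g, ⟨i, hi⟩, ⟨j, hj⟩, ⟨k, hk⟩, rfl⟩

/-- A `J`-class contains at most `8 n` cyclically reduced words, where `n` is their length. -/
theorem finite_relJ_and_ncard_le {u : F₂} (hu : u ≠ 1) :
    {v | RelJ u v ∧ v.norm = cycLen u}.Finite ∧
      {v | RelJ u v ∧ v.norm = cycLen u}.ncard ≤ 8 * cycLen u := by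
  classical
  let π : Fin 2 × Fin 2 × Fin 2 → MulAut F₂ := fun x =>
    swap ^ (x.1 : ℕ) * flip ^ (x.2.1 : ℕ) * (swap * flip * swap) ^ (x.2.2 : ℕ)
  have hπ : ∀ x, π x ∈ J := fun x => J.mul_mem (J.mul_mem (J.pow_mem swap_mem_J _)
    (J.pow_mem flip_mem_J _)) (J.pow_mem (J.mul_mem (J.mul_mem swap_mem_J flip_mem_J) swap_mem_J) _)
  have hne : ∀ x, π x u ≠ 1 := fun x h => hu ((map_eq_one_iff _ (π x).injective).1 h)
  have hcl : ∀ x, cycLen (π x u) = cycLen u := fun x => cycLen_J (hπ x) u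
  have hsub : {v | RelJ u v ∧ v.norm = cycLen u} ⊆
      (Finset.univ.biUnion fun x => (finite_conj_and_ncard_le (hne x)).1.toFinset : Finset F₂) := by
    rintro v ⟨⟨φ, hφ, rfl⟩, hn⟩
    obtain ⟨g, i, j, k, rfl⟩ := exists_conj_mul_permutation hφ
    rw [Finset.mem_coe, Finset.mem_biUnion]
    refine ⟨(i, j, k), Finset.mem_univ _, ?_⟩
    rw [Set.Finite.mem_toFinset]
    refine ⟨isConj_iff.2 ⟨g, rfl⟩, ?_⟩
    rw [hn, hcl]
  refine ⟨(Finset.finite_toSet _).subset hsub, ?_⟩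
  refine (Set.ncard_le_ncard hsub (Finset.finite_toSet _)).trans ?_
  rw [Set.ncard_coe_finset]
  refine Finset.card_biUnion_le.trans ?_
  refine (Finset.sum_le_card_nsmul _ _ (cycLen u) fun x _ => ?_).trans ?_
  · rw [← Set.ncard_eq_toFinset_card _ (finite_conj_and_ncard_le (hne x)).1]
    exact (finite_conj_and_ncard_le (hne x)).2.trans (hcl x).le
  · simp

theorem isMinimal_iff {w : F₂} : IsMinimal w ↔ w.norm = cycLen w ∧ IsLocallyMinimal w := by
  constructor
  · intro h
    have key : ∀ φ : MulAut F₂, w.norm ≤ cycLen (φ w) := by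
      intro φ
      obtain ⟨v, hv, e⟩ := exists_isConj_norm_eq (φ w)
      obtain ⟨g, rfl⟩ := isConj_iff.1 hv
      rw [← e]
      exact h (MulAut.conj g * φ)
    have h1 := le_antisymm (key 1) (cycLen_le_norm w)
    refine ⟨h1, ?_⟩
    rintro v ⟨j, -, rfl⟩
    have := key (tw 1 * j)
    rw [h1] at this
    exact this
  · rintro ⟨h1, h2⟩ φ
    rw [h1]
    exact (h2.le φ).trans (cycLen_le_norm _)

theorem card_Gamma (W : Set F₂) : Nat.card (Gamma W) = (classJ '' minimalWords W).ncard := by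
  rw [← Nat.card_coe_set_eq]
  have : {p : Set F₂ | ∃ w ∈ minimalWords W, p = classJ w} = classJ '' minimalWords W := by
    ext p
    simp only [Set.mem_image, Set.mem_ofPred_eq, eq_comm]
  rw [← this]
  rfl

theorem finite_Gamma_iff (W : Set F₂) : Finite (Gamma W) ↔ (classJ '' minimalWords W).Finite := by
  have : {p : Set F₂ | ∃ w ∈ minimalWords W, p = classJ w} = classJ '' minimalWords W := by
    ext p
    simp only [Set.mem_image, Set.mem_ofPred_eq, eq_comm]
  rw [← this]
  rfl

theorem minimalWords_nonempty {W : Set F₂} (hW : IsAutConjClass W) :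
    (minimalWords W).Nonempty := by
  obtain ⟨w, rfl⟩ := hW
  obtain ⟨φ, hφ⟩ : ∃ φ : MulAut F₂, ∀ ψ : MulAut F₂, (φ w).norm ≤ (ψ w).norm := by
    obtain ⟨φ, hφ⟩ := Nat.sInf_mem (s := Set.range fun φ : MulAut F₂ => (φ w).norm)
      ⟨_, 1, rfl⟩
    exact ⟨φ, fun ψ => (le_of_eq hφ).trans (Nat.sInf_le ⟨ψ, rfl⟩)⟩
  exact ⟨φ w, ⟨φ, rfl⟩, fun ψ => hφ (ψ * φ)⟩

theorem exists_aut_of_mem {W : Set F₂} (hW : IsAutConjClass W) {u v : F₂} (hu : u ∈ W)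
    (hv : v ∈ W) : ∃ φ : MulAut F₂, φ u = v := by
  obtain ⟨w, rfl⟩ := hW
  obtain ⟨φ, rfl⟩ := hu
  obtain ⟨ψ, rfl⟩ := hv
  exact ⟨ψ * φ⁻¹, by simp⟩

/-- There are at most `n - 5` classes `[w]` of minimal words. -/
theorem finite_and_ncard_image_classJ_le {n : ℕ} (hn : 9 ≤ n) {W : Set F₂} (hW : IsAutConjClass W)
    (h : ∀ w ∈ minimalWords W, w.norm = n) :
    (classJ '' minimalWords W).Finite ∧ (classJ '' minimalWords W).ncard ≤ n - 5 := by
  obtain ⟨w, hw⟩ := minimalWords_nonempty hW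
  obtain ⟨h1, h2⟩ := isMinimal_iff.1 hw.2
  have hlen : cycLen w = n := by rw [← h1, h w hw]
  obtain ⟨C, hC, hrep⟩ := exists_reps h2 (hlen ▸ hn)
  have hsub : classJ '' minimalWords W ⊆ classJ '' (C : Set F₂) := by
    rintro _ ⟨v, hv, rfl⟩
    obtain ⟨φ, rfl⟩ := exists_aut_of_mem hW hw.1 hv.1
    obtain ⟨c, hc, hr⟩ := hrep φ (by rw [← (isMinimal_iff.1 hv.2).1, h _ hv, hlen])
    exact ⟨c, hc, hr.classJ_eq⟩
  have hfin : (classJ '' (C : Set F₂)).Finite := (Finset.finite_toSet C).image _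
  refine ⟨hfin.subset hsub, (Set.ncard_le_ncard hsub hfin).trans ?_⟩
  refine (Set.ncard_image_le (Finset.finite_toSet C)).trans ?_
  rw [Set.ncard_coe_finset]
  exact hlen ▸ hC

/-- Each class `[w]` contains at most `8 n` minimal words. -/
theorem finite_and_ncard_minimalWords_le {n : ℕ} (hn : 0 < n) {W : Set F₂}
    (h : ∀ w ∈ minimalWords W, w.norm = n) (hfin : (classJ '' minimalWords W).Finite) :
    (minimalWords W).Finite ∧
      (minimalWords W).ncard ≤ 8 * n * (classJ '' minimalWords W).ncard := by
  classical
  have hfib : ∀ w ∈ minimalWords W, {v | v ∈ minimalWords W ∧ classJ v = classJ w} ⊆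
      {v | RelJ w v ∧ v.norm = cycLen w} := by
    rintro w hw v ⟨hv, e⟩
    have : v ∈ classJ w := e ▸ (RelJ.refl v : v ∈ classJ v)
    exact ⟨this, by rw [h v hv, ← (isMinimal_iff.1 hw.2).1, h w hw]⟩
  have hne : ∀ w ∈ minimalWords W, w ≠ 1 := by
    rintro w hw rfl
    have := h 1 hw
    simp at this
    omega
  have hf : (minimalWords W).Finite := by
    refine Set.Finite.of_finite_fibers classJ hfin ?_
    rintro _ ⟨w, hw, rfl⟩
    exact (finite_relJ_and_ncard_le (hne w hw)).1.subset (hfib w hw)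
  refine ⟨hf, ?_⟩
  have := Finset.card_le_mul_card_image (s := hf.toFinset) (f := classJ) (8 * n) ?_
  · rw [Set.ncard_eq_toFinset_card _ hf]
    refine this.trans_eq ?_
    congr 1
    rw [← Set.ncard_coe_finset, Finset.coe_image, Set.Finite.coe_toFinset]
  · intro p hp
    obtain ⟨w, hw, rfl⟩ := Finset.mem_image.1 hp
    rw [Set.Finite.mem_toFinset] at hw
    have hfw := finite_relJ_and_ncard_le (hne w hw)
    rw [← Set.ncard_coe_finset]
    refine (Set.ncard_le_ncard ?_ hfw.1).trans (hfw.2.trans ?_)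
    · intro v hv
      rw [Finset.mem_coe, Finset.mem_filter, Set.Finite.mem_toFinset] at hv
      exact hfib w hw hv
    · rw [← (isMinimal_iff.1 hw.2).1, h w hw]

/-! ### The extremal classes -/

/-- The syllables of the word `b a^k b a b⁻¹ a^m b⁻¹ a⁻¹`. -/
def extremalSyl (k m : ℤ) : List (Bool × ℤ) := [(true, k), (true, 1), (false, m), (false, -1)]

/-- The word `b a^k b a b⁻¹ a^m b⁻¹ a⁻¹` without its last letter. -/
def extremalInit (k m : ℕ) : List (Fin 2 × Bool) :=
  (1, true) :: (List.replicate k (0, true) ++ (1, true) :: (0, true) :: (1, false) ::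
    (List.replicate m (0, true) ++ [(1, false)]))

/-- The word `b a^k b a b⁻¹ a^m b⁻¹ a⁻¹`. -/
def extremalWord (k m : ℕ) : List (Fin 2 × Bool) := extremalInit k m ++ [(0, false)]

theorem sylWord_extremalSyl (k m : ℕ) : sylWord (extremalSyl k m) = extremalWord k m := by
  simp [extremalSyl, sylWord, extremalWord, extremalInit]

theorem length_extremalWord (k m : ℕ) : (extremalWord k m).length = k + m + 6 := by
  simp [extremalWord, extremalInit]
  omega

theorem terms_extremalSyl (k m : ℤ) :
    terms (extremalSyl k m) true = [(1, k), (0, 1), (-1, m), (0, -1)] := by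
  simp [extremalSyl, terms, nextSign, slope]

theorem isGood_extremalSyl (k m : ℤ) : IsGood (extremalSyl k m) true := by
  intro t ht
  rw [terms_extremalSyl] at ht
  simp only [List.mem_cons, List.not_mem_nil, or_false] at ht
  rcases ht with rfl | rfl | rfl | rfl <;> simp

/-- The twist `b ↦ b a` moves a letter `a` from one block of the extremal word to the other. -/
theorem isConj_tw_extremalSyl (j k m : ℤ) :
    IsConj (tw j (syl (extremalSyl k m))) (syl (extremalSyl (k + j) (m - j))) := by
  have := isConj_tw_syl j (L := extremalSyl k m) (e₀ := true) rfl
  have e : twist j (extremalSyl k m) true = extremalSyl (k + j) (m - j) := by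
    simp [extremalSyl, twist, nextSign, slope, sub_eq_add_neg]
  rwa [e] at this

theorem cycCount_zero_extremalSyl (k m : ℤ) :
    (cycCount 0 (syl (extremalSyl k m)) : ℤ) = |k| + |m| + 2 := by
  rw [(isGood_extremalSyl k m).cycCount_zero rfl, terms_extremalSyl]
  simp
  ring

theorem cycCount_one_extremalSyl (k m : ℤ) : cycCount 1 (syl (extremalSyl k m)) = 4 := by
  rw [(isGood_extremalSyl k m).cycCount_one rfl]
  rfl

theorem isCyclicallyReduced_extremalWord (k m : ℕ) : IsCyclicallyReduced (extremalWord k m) := by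
  rw [← sylWord_extremalSyl]
  exact (isGood_extremalSyl k m).isCyclicallyReduced rfl

theorem mk_extremalWord (k m : ℕ) : mk (extremalWord k m) = syl (extremalSyl k m) := by
  rw [← sylWord_extremalSyl, mk_sylWord]

theorem isLocallyMinimal_extremal (m : ℕ) (hm : 2 ≤ m) :
    IsLocallyMinimal (syl (extremalSyl 1 m)) := by
  set w := syl (extremalSyl 1 m) with hw
  have hA : (cycCount 0 w : ℤ) = m + 3 := by
    rw [cycCount_zero_extremalSyl]; simp; ring
  have h1 : (cycCount 0 (tw 1 w) : ℤ) = m + 3 := by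
    rw [cycCount_of_isConj 0 (isConj_tw_extremalSyl 1 1 m), cycCount_zero_extremalSyl,
      abs_of_nonneg (by norm_num), abs_of_nonneg (by omega)]
    ring
  have h2 : (cycCount 0 (tw (-1) w) : ℤ) = m + 3 := by
    rw [cycCount_of_isConj 0 (isConj_tw_extremalSyl (-1) 1 m), cycCount_zero_extremalSyl,
      abs_of_nonneg (by norm_num), abs_of_nonneg (by omega)]
    ring
  have hB : cycCount 1 w = 4 := cycCount_one_extremalSyl _ _
  have hl : cycLen w = cycCount 0 w + cycCount 1 w := rfl
  rintro v ⟨j, hj, rfl⟩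
  rcases (relJ_moves hj w 1 (Or.inl rfl)).1 with h | h | h | h <;> rw [h.cycLen_eq]
  · rw [cycLen_tw]; omega
  · rw [cycLen_tw]; omega
  · rw [cycLen_tw'_one]; omega
  · rw [cycLen_tw'_neg_one]; omega

/-- The action on letters of the permutation which sends `a` to `x` and `b` to `y`. -/
def letterMap (x y : Fin 2 × Bool) : Fin 2 × Bool → Fin 2 × Bool := fun z =>
  if z.1 = 0 then (x.1, if z.2 then x.2 else !x.2) else (y.1, if z.2 then y.2 else !y.2)

theorem letterMap_injective : ∀ x y : Fin 2 × Bool, x.1 ≠ y.1 →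
    Function.Injective (letterMap x y) := by
  decide

theorem map_mk_letterMap {π : MulAut F₂} {x y : Fin 2 × Bool} (hx : π a = letter x)
    (hy : π b = letter y) (L : List (Fin 2 × Bool)) : π (mk L) = mk (L.map (letterMap x y)) := by
  have hl : ∀ z, π (letter z) = letter (letterMap x y z) := by
    have ea : letter (0, true) = a := rfl
    have eb : letter (1, true) = b := rfl
    have ea' : letter (0, false) = a⁻¹ := by rw [← ea, letter_inv]; rfl
    have eb' : letter (1, false) = b⁻¹ := by rw [← eb, letter_inv]; rfl
    have hinv : ∀ x : Fin 2 × Bool, (letter x)⁻¹ = letter (x.1, !x.2) :=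
      fun x => letter_inv x.1 x.2
    rintro ⟨i, t⟩
    fin_cases i <;> cases t <;> simp [letterMap, ea, eb, ea', eb', hx, hy, hinv]
  induction L with
  | nil => simp [← one_eq_mk]
  | cons z L ih =>
    have e : ∀ (z : Fin 2 × Bool) L, (mk (z :: L) : F₂) = letter z * mk L := by
      intro z L; simp [letter, mul_mk]
    rw [e, map_mul, hl, ih, List.map_cons, e]

theorem count_extremalWord (k m : ℕ) (z : Fin 2 × Bool) :
    (extremalWord k m).count z = if z = (0, true) then k + m + 1 else
      if z = (0, false) then 1 else 2 := by
  obtain ⟨i, t⟩ := z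
  fin_cases i <;> cases t <;>
    simp [extremalWord, extremalInit, List.count_append, List.count_replicate]
  omega

/-- A rotation of a word whose last letter occurs only once is determined by its position. -/
theorem rotate_concat_inj {α : Type*} {L M : List α} {z : α} (hM : z ∉ M)
    (hlen : L.length = M.length) {r s : ℕ} (hr : r ≤ L.length) (hs : s ≤ M.length)
    (h : (L ++ [z]).rotate r = (M ++ [z]).rotate s) : r = s ∧ L = M := by
  have aux : ∀ i, (M ++ [z])[i]? = some z → i = M.length := by
    intro i hi
    rcases lt_trichotomy i M.length with h | h | h
    · rw [List.getElem?_append_left h] at hi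
      exact absurd (List.mem_of_getElem? hi) hM
    · exact h
    · rw [List.getElem?_eq_none (by simp; omega)] at hi
      simp at hi
  have h1 := congrArg (fun K => K[L.length - r]?) h
  rw [List.getElem?_rotate (by simp), List.getElem?_rotate (by simp; omega)] at h1
  have e1 : (L.length - r + r) % (L ++ [z]).length = L.length := by
    rw [Nat.sub_add_cancel hr, List.length_append, List.length_singleton]
    exact Nat.mod_eq_of_lt (Nat.lt_succ_self _)
  rw [e1, List.getElem?_concat_length] at h1
  have h2 := aux _ h1.symm
  rw [List.length_append, List.length_singleton, ← hlen] at h2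
  have hrs : r = s := by
    by_cases hc : L.length - r + s < L.length + 1
    · rw [Nat.mod_eq_of_lt hc] at h2; omega
    · rw [Nat.mod_eq_sub_mod (by omega), Nat.mod_eq_of_lt (by omega)] at h2; omega
  subst hrs
  exact ⟨rfl, (List.append_left_inj _).1 (List.rotate_injective r h)⟩

theorem extremalInit_inj {k m k' m' : ℕ} (h : extremalInit k m = extremalInit k' m') : k = k' := by
  have key : ∀ (k k' : ℕ) (x y : Fin 2 × Bool) (R R' : List (Fin 2 × Bool)), x ≠ y →
      List.replicate k x ++ y :: R = List.replicate k' x ++ y :: R' → k = k' := by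
    intro k
    induction k with
    | zero =>
      intro k' x y R R' hxy h
      cases k' with
      | zero => rfl
      | succ k' =>
        rw [List.replicate_succ] at h
        simp at h
        exact absurd h.1.symm hxy
    | succ k ih =>
      intro k' x y R R' hxy h
      cases k' with
      | zero =>
        rw [List.replicate_succ] at h
        simp at h
        exact absurd h.1 hxy
      | succ k' =>
        rw [List.replicate_succ, List.replicate_succ, List.cons_append, List.cons_append,
          List.cons.injEq] at h
        rw [ih k' x y R R' hxy h.2]
  simp only [extremalInit, List.cons.injEq, true_and] at h
  exact key k k' _ _ _ _ (by decide) h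

theorem not_mem_extremalInit (k m : ℕ) : ((0, false) : Fin 2 × Bool) ∉ extremalInit k m := by
  simp [extremalInit, List.mem_replicate]

/-- The images of the extremal words under permutations and rotations are distinct. -/
theorem extremal_injective {N : ℕ} (hN : 3 ≤ N) {x y x' y' : Fin 2 × Bool} (hxy : x.1 ≠ y.1)
    (hxy' : x'.1 ≠ y'.1) {k k' r r' : ℕ} (hk : k ≤ N) (hk' : k' ≤ N) (hr : r < N + 6)
    (hr' : r' < N + 6)
    (h : ((extremalWord k (N - k)).map (letterMap x y)).rotate r =
      ((extremalWord k' (N - k')).map (letterMap x' y')).rotate r') :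
    x = x' ∧ y = y' ∧ k = k' ∧ r = r' := by
  have inj := letterMap_injective x y hxy
  have inj' := letterMap_injective x' y' hxy'
  -- The image of `a` is the most frequent letter.
  have hx : x = x' := by
    obtain ⟨z, hz⟩ := Finite.surjective_of_injective inj' x
    have e1 : (((extremalWord k (N - k)).map (letterMap x y)).rotate r).count x = N + 1 := by
      rw [(List.rotate_perm _ _).count_eq]
      have := List.count_map_of_injective (extremalWord k (N - k)) _ inj (0, true)
      rw [count_extremalWord, if_pos rfl] at this
      have e : letterMap x y (0, true) = x := by simp [letterMap]
      rw [e] at this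
      omega
    have e2 : (((extremalWord k' (N - k')).map (letterMap x' y')).rotate r').count x =
        (extremalWord k' (N - k')).count z := by
      rw [(List.rotate_perm _ _).count_eq, ← hz, List.count_map_of_injective _ _ inj']
    rw [h, e2, count_extremalWord] at e1
    by_cases hz0 : z = (0, true)
    · rw [← hz, hz0]; simp [letterMap]
    · rw [if_neg hz0] at e1
      split_ifs at e1 <;> omega
  subst hx
  have ez : letterMap x y' (0, false) = letterMap x y (0, false) := by simp [letterMap]
  have len : ∀ k m : ℕ, (extremalInit k m).length = k + m + 5 := by
    intro k m
    have := length_extremalWord k m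
    rw [extremalWord, List.length_append, List.length_singleton] at this
    omega
  unfold extremalWord at h
  rw [List.map_append, List.map_append, List.map_singleton, List.map_singleton, ez] at h
  obtain ⟨h1, h2⟩ := rotate_concat_inj
    (by rw [← ez, List.mem_map_of_injective inj']; exact not_mem_extremalInit _ _)
    (by simp only [List.length_map, len]; omega) (by simp only [List.length_map, len]; omega)
    (by simp only [List.length_map, len]; omega) h
  have hy : y = y' := by
    rw [extremalInit, extremalInit, List.map_cons, List.map_cons, List.cons.injEq] at h2
    simpa [letterMap] using h2.1
  subst hy
  exact ⟨rfl, rfl, extremalInit_inj (List.map_injective_iff.2 inj h2), h1⟩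

/-- The orbit of `b a b a b⁻¹ a^{n-7} b⁻¹ a⁻¹` contains `8 n (n - 5)` minimal words: the images of
the words `b a^k b a b⁻¹ a^m b⁻¹ a⁻¹` with `k + m = n - 6` under the `8` permutations and the `n`
rotations. -/
theorem exists_extremal {n : ℕ} (hn : 9 ≤ n) : ∃ W : Set F₂, IsAutConjClass W ∧
    (∀ w ∈ minimalWords W, w.norm = n) ∧
    ((minimalWords W).Finite → 8 * n * (n - 5) ≤ (minimalWords W).ncard) := by
  obtain ⟨N, rfl⟩ : ∃ N, n = N + 6 := ⟨n - 6, by omega⟩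
  have hN : 3 ≤ N := by omega
  set w := syl (extremalSyl 1 ((N - 1 : ℕ) : ℤ)) with hw
  have hmin : IsLocallyMinimal w := isLocallyMinimal_extremal _ (by omega)
  have hlen : cycLen w = N + 6 := by
    have := mk_extremalWord 1 (N - 1)
    rw [Nat.cast_one] at this
    rw [hw, ← this, cycLen_mk (isCyclicallyReduced_extremalWord _ _), length_extremalWord]
    omega
  let W : Set F₂ := {v | ∃ φ : MulAut F₂, φ w = v}
  have hW : IsAutConjClass W := ⟨w, rfl⟩
  have hnorm : ∀ v ∈ minimalWords W, v.norm = N + 6 := by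
    rintro _ ⟨⟨φ, rfl⟩, hv⟩
    refine le_antisymm ?_ ?_
    · obtain ⟨u, hu, e⟩ := exists_isConj_norm_eq w
      obtain ⟨g, rfl⟩ := isConj_iff.1 hu
      rw [← hlen, ← e]
      have := hv (MulAut.conj g * φ⁻¹)
      simpa using this
    · rw [← hlen]
      exact (hmin.le φ).trans (cycLen_le_norm _)
  have hmem : ∀ v ∈ W, v.norm = N + 6 → v ∈ minimalWords W := by
    rintro _ ⟨φ, rfl⟩ hv
    refine ⟨⟨φ, rfl⟩, fun ψ => ?_⟩
    rw [hv, ← hlen]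
    exact (hmin.le (ψ * φ)).trans (cycLen_le_norm _)
  refine ⟨W, hW, hnorm, fun hfin => ?_⟩
  let P : Finset ((Fin 2 × Bool) × (Fin 2 × Bool)) := Finset.univ.filter fun p => p.1.1 ≠ p.2.1
  have hP : P.card = 8 := by decide
  let D := P ×ˢ Finset.range (N + 1) ×ˢ Finset.range (N + 6)
  let word : ((Fin 2 × Bool) × (Fin 2 × Bool)) × ℕ × ℕ → List (Fin 2 × Bool) := fun p =>
    ((extremalWord p.2.1 (N - p.2.1)).map (letterMap p.1.1 p.1.2)).rotate p.2.2
  have hword : ∀ p ∈ D, IsCyclicallyReduced (word p) ∧ (mk (word p) : F₂) ∈ minimalWords W := by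
    rintro ⟨⟨x, y⟩, k, r⟩ hp
    simp only [D, P, Finset.mem_product, Finset.mem_filter, Finset.mem_univ, true_and,
      Finset.mem_range] at hp
    obtain ⟨hxy, hk, hr⟩ := hp
    obtain ⟨π, hπ, hx, hy⟩ := exists_J_letter hxy
    have hmap := map_mk_letterMap hx hy (extremalWord k (N - k))
    have hl : ((extremalWord k (N - k)).map (letterMap x y)).length = N + 6 := by
      rw [List.length_map, length_extremalWord]; omega
    have hc1 : IsConj (tw ((k : ℤ) - 1) w) (mk (extremalWord k (N - k))) := by
      have := isConj_tw_extremalSyl ((k : ℤ) - 1) 1 ((N - 1 : ℕ) : ℤ)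
      rw [show (1 : ℤ) + ((k : ℤ) - 1) = (k : ℤ) by ring,
        show ((N - 1 : ℕ) : ℤ) - ((k : ℤ) - 1) = ((N - k : ℕ) : ℤ) by omega,
        ← mk_extremalWord] at this
      exact this
    have hcl : cycLen (mk ((extremalWord k (N - k)).map (letterMap x y))) = N + 6 := by
      rw [← hmap, cycLen_J hπ, cycLen_mk (isCyclicallyReduced_extremalWord _ _),
        length_extremalWord]
      omega
    have hle : (mk ((extremalWord k (N - k)).map (letterMap x y)) : F₂).norm ≤ N + 6 :=
      hl ▸ norm_mk_le
    have hge := cycLen_le_norm (mk ((extremalWord k (N - k)).map (letterMap x y)))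
    have htw : (mk ((extremalWord k (N - k)).map (letterMap x y)) : F₂).toWord =
        (extremalWord k (N - k)).map (letterMap x y) := by
      rw [toWord_mk]
      refine (reduce.red.sublist).eq_of_length ?_
      rw [← toWord_mk, hl]
      change FreeGroup.norm _ = _
      omega
    have hcr : IsCyclicallyReduced ((extremalWord k (N - k)).map (letterMap x y)) := by
      rw [← htw]
      exact isCyclicallyReduced_of_norm_eq (by omega)
    have hcr' := isCyclicallyReduced_rotate hcr r
    refine ⟨hcr', hmem _ ?_ ?_⟩
    · obtain ⟨g, hg⟩ := isConj_iff.1 hc1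
      obtain ⟨g', hg'⟩ := isConj_iff.1
        (isConj_mk_rotate ((extremalWord k (N - k)).map (letterMap x y)) r)
      refine ⟨MulAut.conj g' * (π * (MulAut.conj g * tw ((k : ℤ) - 1))), ?_⟩
      simp only [MulAut.mul_apply, MulAut.conj_apply, hg, hmap, hg']
      rfl
    · rw [norm_mk_of_isReduced hcr'.isReduced, List.length_rotate, hl]
  have hinj : Set.InjOn (fun p => (mk (word p) : F₂)) D := by
    rintro ⟨⟨x, y⟩, k, r⟩ hp ⟨⟨x', y'⟩, k', r'⟩ hp' e
    have h1 := (hword _ hp).1.isReduced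
    have h2 := (hword _ hp').1.isReduced
    have e' : word ((x, y), k, r) = word ((x', y'), k', r') := by
      have := congrArg toWord e
      simp only [toWord_mk, h1.reduce_eq, h2.reduce_eq] at this
      exact this
    simp only [D, P, Finset.coe_product, Set.mem_prod, Finset.mem_coe, Finset.mem_filter,
      Finset.mem_univ, true_and, Finset.mem_range] at hp hp'
    obtain ⟨rfl, rfl, rfl, rfl⟩ := extremal_injective hN hp.1 hp'.1
      (Nat.lt_succ_iff.1 hp.2.1) (Nat.lt_succ_iff.1 hp'.2.1) hp.2.2 hp'.2.2 e'
    rfl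
  have hsub : ((D.image fun p => (mk (word p) : F₂) : Finset F₂) : Set F₂) ⊆ minimalWords W := by
    intro v hv
    obtain ⟨p, hp, rfl⟩ := Finset.mem_image.1 (Finset.mem_coe.1 hv)
    exact (hword p hp).2
  have hcard : (D.image fun p => (mk (word p) : F₂)).card = 8 * (N + 6) * (N + 1) := by
    rw [Finset.card_image_of_injOn hinj, Finset.card_product, Finset.card_product, hP,
      Finset.card_range, Finset.card_range]
    ring
  have := Set.ncard_le_ncard hsub hfin
  rw [Set.ncard_coe_finset, hcard] at this
  exact this

end FreeTwo

theorem theorem1 (n : ℕ) (hn : 9 ≤ n) :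
    (∀ W : Set FreeTwo.F₂, FreeTwo.IsAutConjClass W →
      (∀ w ∈ FreeTwo.minimalWords W, w.norm = n) →
        (Finite (FreeTwo.Gamma W) ∧ Nat.card (FreeTwo.Gamma W) ≤ n - 5) ∧
        ((FreeTwo.minimalWords W).Finite ∧
          (FreeTwo.minimalWords W).ncard ≤ 8 * n ^ 2 - 40 * n)) ∧
    (∃ W : Set FreeTwo.F₂, FreeTwo.IsAutConjClass W ∧
      (∀ w ∈ FreeTwo.minimalWords W, w.norm = n) ∧
        Nat.card (FreeTwo.Gamma W) = n - 5 ∧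
        (FreeTwo.minimalWords W).ncard = 8 * n ^ 2 - 40 * n) := by
  have harith : 8 * n * (n - 5) = 8 * n ^ 2 - 40 * n := by
    rw [Nat.mul_sub]
    congr 1 <;> ring
  have hpos : 0 < n := by omega
  refine ⟨fun W hW h => ?_, ?_⟩
  · obtain ⟨h1, h2⟩ := FreeTwo.finite_and_ncard_image_classJ_le hn hW h
    obtain ⟨h3, h4⟩ := FreeTwo.finite_and_ncard_minimalWords_le hpos h h1
    refine ⟨⟨(FreeTwo.finite_Gamma_iff W).2 h1, (FreeTwo.card_Gamma W).trans_le h2⟩, h3, ?_⟩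
    rw [← harith]
    exact h4.trans (Nat.mul_le_mul_left _ h2)
  · obtain ⟨W, hW, h, hge⟩ := FreeTwo.exists_extremal hn
    obtain ⟨h1, h2⟩ := FreeTwo.finite_and_ncard_image_classJ_le hn hW h
    obtain ⟨h3, h4⟩ := FreeTwo.finite_and_ncard_minimalWords_le hpos h h1
    have h5 := hge h3
    have h6 : n - 5 ≤ (FreeTwo.classJ '' FreeTwo.minimalWords W).ncard :=
      Nat.le_of_mul_le_mul_left (h5.trans h4) (by omega)
    refine ⟨W, hW, h, ?_, ?_⟩
    · rw [FreeTwo.card_Gamma]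
      exact le_antisymm h2 h6
    · rw [← harith]
      exact le_antisymm (h4.trans (Nat.mul_le_mul_left _ h2)) h5
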